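/- Let $(R,\mathfrak m,k)$ be either a noetherian local ring with maximal ideal $\mathfrak m$ and residue field $k=R/\mathfrak m$, or a standard graded algebra over a field $k$ with graded maximal ideal $\mathfrak m$; in the second case all modules are $\mathbb Z$-graded, homomorphisms are homogeneous of degree $0$, and resolutions are graded. For a finitely generated $R$-module $M$ with minimal free resolution $F$, filter $F$ by the subcomplexes $\mathcal G^nF$ with $(\mathcal G^nF)_i=\mathfrak m^{n-i}F_i$ (where $\mathfrak m^j=R$ for $j\le 0$), let $\operatorname{lin}^RF$ be the associated graded complex, and define the linearity defect $\operatorname{lind}_RM=\sup\{i : H_i(\operatorname{lin}^RF)\ne 0\}\in\mathbb N\cup\{\infty\}$. Let $0\to M\xrightarrow{\phi}P\xrightarrow{\lambda}N\to 0$ be a short exact sequence of nonzero finitely generated $R$-modules. Define the (possibly infinite) numbers \begin{align*} d_M&=\inf\{m\ge 0:\text{the connecting map }\operatorname{Tor}^R_{i+1}(k,N)\to\operatorname{Tor}^R_i(k,M)\text{ is zero for all }i\ge m\},\\ d_P&=\inf\{m\ge 0:\operatorname{Tor}^R_i(k,\phi):\operatorname{Tor}^R_i(k,M)\to\operatorname{Tor}^R_i(k,P)\text{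 is zero for all }i\ge m\},\\ d_N&=\inf\{m\ge 0:\operatorname{Tor}^R_i(k,\lambda):\operatorname{Tor}^R_i(k,P)\to\operatorname{Tor}^R_i(k,N)\text{ is zero for all }i\ge m\}. \end{align*} Then \begin{enumerate} \item $\operatorname{lind}_RN\le\max\{\min\{d_P,d_M+1\},\operatorname{lind}_RP,\operatorname{lind}_RM+1\}$; \item $\operatorname{lind}_RP\le\max\{\min\{d_M,d_N\},\operatorname{lind}_RM,\operatorname{lind}_RN\}$; \item $\operatorname{lind}_RM\le\max\{\min\{d_N-1,d_P\},\operatorname{lind}_RN-1,\operatorname{lind}_RP\}$. \end{enumerate} -/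

import Mathlib

open CategoryTheory MonoidalCategory
open scoped DirectSum

universe u v

noncomputable section

namespace LinDefect

/-! ### Minimal free resolutions and their linear part -/

section Resolutions

variable {R : Type u} [CommRing R]

/-- A free resolution `⋯ → F₂ → F₁ → F₀ → M → 0` of `M` by free modules of finite rank
`Fᵢ = R ^ rank i` that is minimal with respect to the ideal `I`: the differential maps `Fᵢ₊₁`
into `I Fᵢ`. It is used with `I` the maximal ideal of a local ring, or the graded maximal ideal
of a standard graded algebra. -/
structure MinimalFreeResolution (I : Ideal R) (M : Type u) [AddCommGroup M] [Module R M] where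
  /-- the ranks of the free modules -/
  rank : ℕ → ℕ
  /-- the differential -/
  d : ∀ i, (Fin (rank (i + 1)) → R) →ₗ[R] (Fin (rank i) → R)
  /-- the augmentation -/
  ε : (Fin (rank 0) → R) →ₗ[R] M
  ε_surjective : Function.Surjective ε
  exact_zero : Function.Exact (d 0) ε
  exact_succ : ∀ i, Function.Exact (d (i + 1)) (d i)
  minimal : ∀ i, LinearMap.range (d i) ≤ I • (⊤ : Submodule R (Fin (rank i) → R))

namespace MinimalFreeResolution

variable {I : Ideal R} {M : Type u} [AddCommGroup M] [Module R M]
  (F : MinimalFreeResolution I M)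

/-- The filtration `(𝒢ⁿF)ᵢ = I ^ (n - i) Fᵢ`, where `I ^ j = R` for `j ≤ 0` (the subtraction of
natural numbers is truncated, which is exactly this convention). -/
def filtration (n i : ℕ) : Submodule R (Fin (F.rank i) → R) :=
  I ^ (n - i) • (⊤ : Submodule R (Fin (F.rank i) → R))

lemma filtration_succ_le_comap (n i : ℕ) :
    F.filtration n (i + 1) ≤ (F.filtration n i).comap (F.d i) := by
  rw [← Submodule.map_le_iff_le_comap, filtration, filtration, Submodule.map_smul'',
    Submodule.map_top]
  rcases Nat.lt_or_ge i n with h | h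
  · have e : n - i = (n - (i + 1)) + 1 := by omega
    rw [e, pow_succ, Submodule.mul_smul]
    exact smul_mono_right _ (F.minimal i)
  · have e : n - i = 0 := by omega
    rw [e, pow_zero, Ideal.one_eq_top, Submodule.top_smul]
    exact le_top

/-- The graded piece `(𝒢ⁿF)ᵢ / (𝒢ⁿ⁺¹F)ᵢ`. -/
def grPiece (n i : ℕ) : Type u :=
  F.filtration n i ⧸ (F.filtration (n + 1) i).submoduleOf (F.filtration n i)

instance (n i : ℕ) : AddCommGroup (F.grPiece n i) :=
  inferInstanceAs (AddCommGroup
    (F.filtration n i ⧸ (F.filtration (n + 1) i).submoduleOf (F.filtration n i)))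

instance (n i : ℕ) : Module R (F.grPiece n i) :=
  inferInstanceAs (Module R
    (F.filtration n i ⧸ (F.filtration (n + 1) i).submoduleOf (F.filtration n i)))

/-- The quotient map `(𝒢ⁿF)ᵢ → (𝒢ⁿF)ᵢ / (𝒢ⁿ⁺¹F)ᵢ`. -/
def grMk (n i : ℕ) : F.filtration n i →ₗ[R] F.grPiece n i :=
  ((F.filtration (n + 1) i).submoduleOf (F.filtration n i)).mkQ

lemma grMk_surjective (n i : ℕ) : Function.Surjective (F.grMk n i) :=
  Submodule.mkQ_surjective _

/-- The differential of `F` restricted to `(𝒢ⁿF)ᵢ₊₁ → (𝒢ⁿF)ᵢ`. -/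
def filtrationD (n i : ℕ) : F.filtration n (i + 1) →ₗ[R] F.filtration n i :=
  (F.d i).restrict fun _ hx => F.filtration_succ_le_comap n i hx

/-- The differential induced on the graded pieces. -/
def grD (n i : ℕ) : F.grPiece n (i + 1) →ₗ[R] F.grPiece n i :=
  Submodule.mapQ ((F.filtration (n + 1) (i + 1)).submoduleOf (F.filtration n (i + 1)))
    ((F.filtration (n + 1) i).submoduleOf (F.filtration n i)) (F.filtrationD n i) (by
    intro x hx
    exact F.filtration_succ_le_comap (n + 1) i hx)

lemma grD_grMk (n i : ℕ) (x : F.filtration n (i + 1)) :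
    F.grD n i (F.grMk n (i + 1) x) = F.grMk n i (F.filtrationD n i x) := rfl

lemma grD_comp_grD (n i : ℕ) : F.grD n i ∘ₗ F.grD n (i + 1) = 0 := by
  apply LinearMap.ext
  intro x
  obtain ⟨x, rfl⟩ := F.grMk_surjective _ _ x
  have h : F.filtrationD n i (F.filtrationD n (i + 1) x) = 0 :=
    Subtype.ext ((F.exact_succ i).apply_apply_eq_zero x.1)
  rw [LinearMap.comp_apply, grD_grMk, grD_grMk, h, map_zero, LinearMap.zero_apply]

/-- The linear part of `F`: the associated graded complex of the filtration `𝒢`, with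
`i`-th module `⨁ₙ (𝒢ⁿF)ᵢ / (𝒢ⁿ⁺¹F)ᵢ`. -/
def linearPart : ChainComplex (ModuleCat.{u} R) ℕ :=
  ChainComplex.of (fun i => ModuleCat.of R (⨁ n, F.grPiece n i))
    (fun i => ModuleCat.ofHom (DirectSum.lmap fun n => F.grD n i))
    (fun i => by
      rw [← ModuleCat.ofHom_comp, ← DirectSum.lmap_comp]
      simp only [grD_comp_grD]
      ext : 1
      apply LinearMap.ext
      intro x
      ext n
      simp [DirectSum.lmap_apply])

/-- `sup {i : Hᵢ(linearPart F) ≠ 0}`, which is `0` if there is no such `i`. -/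
def defect : ℕ∞ :=
  ⨆ (i : ℕ) (_ : ¬ Limits.IsZero (F.linearPart.homology i)), (i : ℕ∞)

end MinimalFreeResolution

end Resolutions

/-- The linearity defect `lind_R M` of a finitely generated module over a noetherian local ring.
A minimal free resolution of `M` exists and is unique up to isomorphism of complexes, so that the
supremum over all of them is the value at any one of them. -/
def lind (R : Type u) [CommRing R] [IsLocalRing R] (M : Type u) [AddCommGroup M] [Module R M] :
    ℕ∞ :=
  ⨆ F : MinimalFreeResolution (IsLocalRing.maximalIdeal R) M, F.defect

/-! ### The standard graded case -/

section Graded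

variable {k : Type v} [Field k] {R : Type u} [CommRing R] [Algebra k R]

/-- A standard graded `k`-algebra: `R₀ = k`, and `R` is generated as a `k`-algebra by `R₁`, which
has finite dimension over `k`. -/
structure IsStandardGraded (𝒜 : ℕ → Submodule k R) [GradedAlgebra 𝒜] : Prop where
  nontrivial : Nontrivial R
  zero_eq : 𝒜 0 = 1
  adjoin_one : Algebra.adjoin k (𝒜 1 : Set R) = ⊤
  fg_one : (𝒜 1).FG

/-- The graded maximal ideal `⨁_{n > 0} Rₙ`. -/
abbrev gradedMaxIdeal (𝒜 : ℕ → Submodule k R) [GradedAlgebra 𝒜] : Ideal R :=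
  (HomogeneousIdeal.irrelevant 𝒜).toIdeal

/-- `ℳ` is a `ℤ`-grading on the `R`-module `M`. -/
structure IsGradedModule (𝒜 : ℕ → Submodule k R) {M : Type u} [AddCommGroup M] [Module R M]
    (ℳ : ℤ → AddSubgroup M) : Prop where
  isInternal : DirectSum.IsInternal ℳ
  smul_mem : ∀ {i : ℕ} {j : ℤ} {a : R} {x : M}, a ∈ 𝒜 i → x ∈ ℳ j → a • x ∈ ℳ (i + j)

/-- The homogeneous component `Rₙ` for any integer `n` (zero for `n < 0`). -/
def component (𝒜 : ℕ → Submodule k R) : ℤ → Submodule k R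
  | Int.ofNat n => 𝒜 n
  | Int.negSucc _ => ⊥

/-- A minimal graded free resolution: `Fᵢ = ⨁ⱼ R(-deg i j)`, that is, the `j`-th basis vector of
`Fᵢ` has degree `deg i j`, and all maps are homogeneous of degree `0`. -/
structure MinimalGradedFreeResolution (𝒜 : ℕ → Submodule k R) [GradedAlgebra 𝒜]
    {M : Type u} [AddCommGroup M] [Module R M] (ℳ : ℤ → AddSubgroup M) extends
    MinimalFreeResolution (gradedMaxIdeal 𝒜) M where
  /-- the degrees of the basis vectors -/
  deg : ∀ i, Fin (rank i) → ℤ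
  ε_mem : ∀ j, ε (Pi.single j 1) ∈ ℳ (deg 0 j)
  d_mem : ∀ i j l, d i (Pi.single j 1) l ∈ component 𝒜 (deg (i + 1) j - deg i l)

/-- The linearity defect of a finitely generated graded module over a standard graded algebra
(with respect to its minimal graded free resolution, unique up to isomorphism). -/
def gradedLind (𝒜 : ℕ → Submodule k R) [GradedAlgebra 𝒜]
    {M : Type u} [AddCommGroup M] [Module R M] (ℳ : ℤ → AddSubgroup M) : ℕ∞ :=
  ⨆ F : MinimalGradedFreeResolution 𝒜 ℳ, F.toMinimalFreeResolution.defect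

end Graded

/-! ### Tor and its long exact sequence -/

section Tor

variable {R : Type u} [CommRing R] (I : Ideal R)
  {M P N : Type u} [AddCommGroup M] [Module R M] [AddCommGroup P] [Module R P]
  [AddCommGroup N] [Module R N]

/-- The residue ring `R / I` as an object of the category of modules. -/
abbrev resMod : ModuleCat.{u} R := ModuleCat.of R (R ⧸ I)

/-- `Torᵢ(R / I, M)`, as the value at `R / I` of the `i`-th left derived functor of `- ⊗ M`. -/
abbrev torMod (i : ℕ) (M : Type u) [AddCommGroup M] [Module R M] : ModuleCat.{u} R :=
  ((Tor' (ModuleCat.{u} R) i).obj (resMod I)).obj (ModuleCat.of R M)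

/-- The natural map `Torᵢ(R / I, φ) : Torᵢ(R / I, M) → Torᵢ(R / I, P)`. -/
abbrev torMap (i : ℕ) (φ : M →ₗ[R] P) : torMod I i M ⟶ torMod I i P :=
  ((Tor' (ModuleCat.{u} R) i).obj (resMod I)).map (ModuleCat.ofHom φ)

/-- For a projective resolution `Q` of `R / I` and a short exact sequence
`0 → M → P → N → 0` of modules, the sequence `0 → Q ⊗ M → Q ⊗ P → Q ⊗ N → 0` of complexes. -/
def tensorSequence (φ : M →ₗ[R] P) (ψ : P →ₗ[R] N) (h : Function.Exact φ ψ)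
    (Q : ChainComplex (ModuleCat.{u} R) ℕ) :
    ShortComplex (ChainComplex (ModuleCat.{u} R) ℕ) where
  X₁ := (((tensoringRight (ModuleCat.{u} R)).obj (ModuleCat.of R M)).mapHomologicalComplex _).obj Q
  X₂ := (((tensoringRight (ModuleCat.{u} R)).obj (ModuleCat.of R P)).mapHomologicalComplex _).obj Q
  X₃ := (((tensoringRight (ModuleCat.{u} R)).obj (ModuleCat.of R N)).mapHomologicalComplex _).obj Q
  f := (NatTrans.mapHomologicalComplex
    ((tensoringRight (ModuleCat.{u} R)).map (ModuleCat.ofHom φ)) _).app Q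
  g := (NatTrans.mapHomologicalComplex
    ((tensoringRight (ModuleCat.{u} R)).map (ModuleCat.ofHom ψ)) _).app Q
  zero := by
    ext1 n
    change Q.X n ◁ ModuleCat.ofHom φ ≫ Q.X n ◁ ModuleCat.ofHom ψ = 0
    rw [← MonoidalCategory.whiskerLeft_comp, ← ModuleCat.ofHom_comp, h.linearMap_comp_eq_zero]
    exact MonoidalPreadditive.whiskerLeft_zero

lemma tensorSequence_shortExact (φ : M →ₗ[R] P) (ψ : P →ₗ[R] N)
    (hφ : Function.Injective φ) (h : Function.Exact φ ψ) (hψ : Function.Surjective ψ)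
    (Q : ChainComplex (ModuleCat.{u} R) ℕ) [∀ n, Projective (Q.X n)] :
    (tensorSequence φ ψ h Q).ShortExact := by
  apply HomologicalComplex.shortExact_of_degreewise_shortExact
  intro n
  have : Module.Projective R (Q.X n) := (IsProjective.iff_projective (Q.X n)).2 inferInstance
  have hS : (ShortComplex.mk (ModuleCat.ofHom φ) (ModuleCat.ofHom ψ) (by
      rw [← ModuleCat.ofHom_comp, h.linearMap_comp_eq_zero]; rfl)).ShortExact :=
    { exact := (ShortComplex.ShortExact.moduleCat_exact_iff_function_exact _).2 h
      mono_f := (ModuleCat.mono_iff_injective _).2 hφ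
      epi_g := (ModuleCat.epi_iff_surjective _).2 hψ }
  exact hS.map_of_exact (tensorLeft (Q.X n))

/-- The connecting map `Torᵢ₊₁(R / I, N) → Torᵢ(R / I, M)` of the short exact sequence
`0 → M → P → N → 0`. -/
def torConnecting (φ : M →ₗ[R] P) (ψ : P →ₗ[R] N)
    (hφ : Function.Injective φ) (h : Function.Exact φ ψ) (hψ : Function.Surjective ψ) (i : ℕ) :
    torMod I (i + 1) N ⟶ torMod I i M :=
  ((projectiveResolution (resMod I)).isoLeftDerivedObj
      ((tensoringRight (ModuleCat.{u} R)).obj (ModuleCat.of R N)) (i + 1)).hom ≫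
    (tensorSequence_shortExact φ ψ hφ h hψ (projectiveResolution (resMod I)).complex).δ
      (i + 1) i rfl ≫
    ((projectiveResolution (resMod I)).isoLeftDerivedObj
      ((tensoringRight (ModuleCat.{u} R)).obj (ModuleCat.of R M)) i).inv

/-- `inf {m ≥ 0 : p i for all i ≥ m}`, which is infinite if there is no such `m`. -/
def infIndex (p : ℕ → Prop) : ℕ∞ :=
  ⨅ (m : ℕ) (_ : ∀ i, m ≤ i → p i), (m : ℕ∞)

/-- The index from which the map `Torᵢ(R / I, φ)` vanishes. -/
def dMap (φ : M →ₗ[R] P) : ℕ∞ := infIndex fun i => torMap I i φ = 0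

/-- The index from which the connecting map `Torᵢ₊₁(R / I, N) → Torᵢ(R / I, M)` vanishes. -/
def dConnecting (φ : M →ₗ[R] P) (ψ : P →ₗ[R] N)
    (hφ : Function.Injective φ) (h : Function.Exact φ ψ) (hψ : Function.Surjective ψ) : ℕ∞ :=
  infIndex fun i => torConnecting I φ ψ hφ h hψ i = 0

end Tor

end LinDefect

end

noncomputable section

open scoped TensorProduct

namespace LinDefect

/-! ### Submodules `J • ⊤` -/

section SmulTop

variable {R : Type*} [CommRing R] {A B : Type*} [AddCommGroup A] [Module R A]
  [AddCommGroup B] [Module R B]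

/-! The linearity defect can be read off from Tor. For a minimal free resolution `F`, the defect is
at most `D` exactly when, for all `i ≥ D` and all `q`, every `x ∈ Fᵢ₊₁` with `dx ∈ I ^ (q + 1) Fᵢ`
lies in `I ^ q Fᵢ₊₁` up to a boundary; that is, `Torᵢ₊₁(R / I ^ (q + 1), -) → Torᵢ₊₁(R / I ^ q, -)`
vanishes on the module (`torMapsVanish_of_defect_le`, `defect_le`). This condition, `TorMapsVanish`,
makes sense for any complex and passes to homotopy retracts. So the resolution of `P` may be
compared with the horseshoe extension of the resolutions of `N` and `M`, whose differential is `(x,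
y) ↦ (dx + δy, dy)` and which need not be minimal.

If a map on `Tor(R / I, -)` is zero in degree `j`, the map it comes from on minimal resolutions has
image in `I` times its target there (`lift_mem_of_torMap_eq_zero`, and
`connecting_mem_of_torConnecting_eq_zero` for `δ`). Each such containment supplies one extra power
of `I`, which is what an element chase through the extension needs. There are six chases, two for
each inequality, one for each argument of the minimum; `defect_le_of_shortExact` assembles them for
an arbitrary ideal `I`. The local and the graded case differ only in the existence of minimal
resolutions, where the graded one must be built from homogeneous generators. -/

lemma map_mem_smul_top (J : Ideal R) (f : A →ₗ[R] B) {x : A}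
    (hx : x ∈ J • (⊤ : Submodule R A)) : f x ∈ J • (⊤ : Submodule R B) := by
  have h := Submodule.mem_map_of_mem (f := f) hx
  rw [Submodule.map_smul''] at h
  exact Submodule.smul_mono le_rfl le_top h

/-- The gain of one power of `I`; each of the six chases uses its vanishing hypothesis through this
lemma. -/
lemma map_mem_pow_succ_smul_top {I : Ideal R} {f : A →ₗ[R] B}
    (hf : ∀ x, f x ∈ I • (⊤ : Submodule R B)) {q : ℕ} {x : A}
    (hx : x ∈ I ^ q • (⊤ : Submodule R A)) : f x ∈ I ^ (q + 1) • (⊤ : Submodule R B) := by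
  have h := Submodule.mem_map_of_mem (f := f) hx
  rw [Submodule.map_smul''] at h
  rw [pow_succ, Submodule.mul_smul]
  refine Submodule.smul_mono le_rfl ?_ h
  rintro _ ⟨y, -, rfl⟩
  exact hf y

lemma mem_pow_smul_top_of_le {I : Ideal R} {p q : ℕ} (h : p ≤ q) {x : A}
    (hx : x ∈ I ^ q • (⊤ : Submodule R A)) : x ∈ I ^ p • (⊤ : Submodule R A) :=
  Submodule.smul_mono_left (Ideal.pow_le_pow_right h) hx

lemma mem_pow_zero_smul_top (I : Ideal R) (x : A) : x ∈ I ^ 0 • (⊤ : Submodule R A) := by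
  rw [pow_zero, Ideal.one_eq_top, Submodule.top_smul]
  trivial

lemma mem_smul_top_prod {J : Ideal R} {x : A × B} :
    x ∈ J • (⊤ : Submodule R (A × B)) ↔
      x.1 ∈ J • (⊤ : Submodule R A) ∧ x.2 ∈ J • (⊤ : Submodule R B) := by
  refine ⟨fun h => ⟨map_mem_smul_top J (LinearMap.fst R A B) h,
    map_mem_smul_top J (LinearMap.snd R A B) h⟩, fun h => ?_⟩
  have := add_mem (map_mem_smul_top J (LinearMap.inl R A B) h.1)
    (map_mem_smul_top J (LinearMap.inr R A B) h.2)
  simpa using this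

lemma mem_smul_top_pi {ι : Type*} [Finite ι] {J : Ideal R} {x : ι → R} :
    x ∈ J • (⊤ : Submodule R (ι → R)) ↔ ∀ i, x i ∈ J := by
  classical
  cases nonempty_fintype ι
  refine ⟨fun h i => ?_, fun h => ?_⟩
  · have := map_mem_smul_top J (LinearMap.proj (R := R) (φ := fun _ : ι => R) i) h
    simpa using this
  · rw [pi_eq_sum_univ' x]
    refine Submodule.sum_mem _ fun i _ => ?_
    exact Submodule.smul_mem_smul (h i) trivial

end SmulTop

/-! ### Recursive constructions, chain maps and homotopies -/

/-- Dependent choice carrying an invariant `p`. Chain maps, homotopies, the horseshoe and minimal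
resolutions are all built degree by degree from it. -/
lemma exists_seq {α : ℕ → Type*} (p : ∀ i, α i → Prop) (r : ∀ i, α i → α (i + 1) → Prop)
    (h0 : ∃ a, p 0 a) (hs : ∀ i a, p i a → ∃ b, p (i + 1) b ∧ r i a b) :
    ∃ a : ∀ i, α i, (∀ i, p i (a i)) ∧ ∀ i, r i (a i) (a (i + 1)) := by
  classical
  choose s hs using hs
  let t : ∀ i, {a : α i // p i a} := fun i =>
    Nat.rec ⟨h0.choose, h0.choose_spec⟩ (fun i a => ⟨s i a.1 a.2, (hs i a.1 a.2).1⟩) i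
  exact ⟨fun i => (t i).1, fun i => (t i).2, fun i => (hs i (t i).1 (t i).2).2⟩

section Complexes

variable {R : Type*} [CommRing R] {X Y : ℕ → Type*}
  [∀ i, AddCommGroup (X i)] [∀ i, Module R (X i)]
  [∀ i, AddCommGroup (Y i)] [∀ i, Module R (Y i)]
  {A B : Type*} [AddCommGroup A] [Module R A] [AddCommGroup B] [Module R B]

lemma exists_lift_of_range_le [Module.Projective R A] {Z : Type*} [AddCommGroup Z] [Module R Z]
    (g : Z →ₗ[R] B) (f : A →ₗ[R] B) (h : ∀ x, ∃ z, g z = f x) :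
    ∃ l : A →ₗ[R] Z, ∀ x, g (l x) = f x := by
  obtain ⟨l, hl⟩ := Module.projective_lifting_property (LinearMap.rangeRestrict g)
    (f.codRestrict (LinearMap.range g) h) (LinearMap.surjective_rangeRestrict g)
  exact ⟨l, fun x => congrArg Subtype.val (LinearMap.congr_fun hl x)⟩

variable (dX : ∀ i, X (i + 1) →ₗ[R] X i) (εX : X 0 →ₗ[R] A)
  (dY : ∀ i, Y (i + 1) →ₗ[R] Y i) (εY : Y 0 →ₗ[R] B)

/-- The comparison theorem: existence. -/
lemma exists_chainMap [∀ i, Module.Projective R (X i)]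
    (hX0 : ∀ x, εX (dX 0 x) = 0) (hX : ∀ i x, dX i (dX (i + 1) x) = 0)
    (hYs : Function.Surjective εY) (hY0 : Function.Exact (dY 0) εY)
    (hY : ∀ i, Function.Exact (dY (i + 1)) (dY i)) (φ : A →ₗ[R] B) :
    ∃ f : ∀ i, X i →ₗ[R] Y i, (∀ x, εY (f 0 x) = φ (εX x)) ∧
      ∀ i x, dY i (f (i + 1) x) = f i (dX i x) := by
  obtain ⟨f0, hf0⟩ := exists_lift_of_range_le εY (φ ∘ₗ εX) fun x => hYs _
  obtain ⟨f, h1, h2⟩ := exists_seq (α := fun i => X i →ₗ[R] Y i)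
    -- The second half of the invariant pins degree `0` to `f0`: `exists_seq` does not reveal its
    -- starting value, and compatibility with the augmentations depends on it.
    (fun i f => (∀ x, ∃ y, dY i y = f (dX i x)) ∧ ∀ h : i = 0, h ▸ f = f0)
    (fun i f f' => ∀ x, dY i (f' x) = f (dX i x))
    ⟨f0, fun x => (hY0 _).1 (by rw [hf0, LinearMap.comp_apply, hX0, map_zero]), fun _ => rfl⟩
    (fun i f hf => by
      obtain ⟨f', hf'⟩ := exists_lift_of_range_le (dY i) (f ∘ₗ dX i) hf.1
      refine ⟨f', ⟨fun x => (hY i _).1 ?_, fun h => absurd h (Nat.succ_ne_zero i)⟩, hf'⟩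
      rw [hf', LinearMap.comp_apply, hX, map_zero])
  refine ⟨f, fun x => ?_, h2⟩
  have : f 0 = f0 := (h1 0).2 rfl
  rw [this, hf0, LinearMap.comp_apply]

/-- The comparison theorem: uniqueness up to homotopy. -/
lemma exists_homotopy_zero [∀ i, Module.Projective R (X i)]
    (hX : ∀ i x, dX i (dX (i + 1) x) = 0) (hY0 : Function.Exact (dY 0) εY)
    (hY : ∀ i, Function.Exact (dY (i + 1)) (dY i)) (f : ∀ i, X i →ₗ[R] Y i)
    (hf0 : ∀ x, εY (f 0 x) = 0) (hf : ∀ i x, dY i (f (i + 1) x) = f i (dX i x)) :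
    ∃ h : ∀ i, X i →ₗ[R] Y (i + 1),
      ∀ i x, f (i + 1) x = dY (i + 1) (h (i + 1) x) + h i (dX i x) := by
  obtain ⟨h0, hh0⟩ := exists_lift_of_range_le (dY 0) (f 0) fun x => (hY0 _).1 (hf0 x)
  obtain ⟨h, -, h2⟩ := exists_seq (α := fun i => X i →ₗ[R] Y (i + 1))
    (fun i h => ∀ x, dY i (f (i + 1) x - h (dX i x)) = 0)
    (fun i h h' => ∀ x, dY (i + 1) (h' x) = f (i + 1) x - h (dX i x))
    ⟨h0, fun x => by rw [map_sub, hh0, hf, sub_self]⟩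
    (fun i h hh => by
      obtain ⟨h', hh'⟩ := exists_lift_of_range_le (dY (i + 1)) (f (i + 1) - h ∘ₗ dX i)
        fun x => (hY i _).1 (hh x)
      refine ⟨h', fun x => ?_, hh'⟩
      rw [map_sub, hh', hf, LinearMap.sub_apply, LinearMap.comp_apply, hX, map_zero, sub_zero,
        sub_self])
  exact ⟨h, fun i x => by rw [h2]; abel⟩

/-- The maps `Torᵢ₊₁(R / I ^ (q + 1), -) → Torᵢ₊₁(R / I ^ q, -)`, computed with the complex `dX`
of free modules, are zero for all `q`. -/
def TorMapsVanish (I : Ideal R) (i : ℕ) : Prop :=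
  ∀ (q : ℕ) (x : X (i + 1)), dX i x ∈ I ^ (q + 1) • (⊤ : Submodule R (X i)) →
    ∃ y : X (i + 2), x - dX (i + 1) y ∈ I ^ q • (⊤ : Submodule R (X (i + 1)))

variable {dX dY}

/-- Linear maps preserve the submodules `I ^ q • ⊤`, so the condition can be tested on `f x` and
carried back by `g`. The homotopy costs a boundary and the term `s (dx)`, which already lies in `I ^
(q + 1)`. -/
lemma TorMapsVanish.of_homotopy_retract {I : Ideal R} {i : ℕ} (h : TorMapsVanish dY I i)
    (f : ∀ i, X i →ₗ[R] Y i) (hf : ∀ i x, dY i (f (i + 1) x) = f i (dX i x))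
    (g : ∀ i, Y i →ₗ[R] X i) (hg : ∀ i x, dX i (g (i + 1) x) = g i (dY i x))
    (s : ∀ i, X i →ₗ[R] X (i + 1))
    (hs : ∀ i x, g (i + 1) (f (i + 1) x) - x = dX (i + 1) (s (i + 1) x) + s i (dX i x)) :
    TorMapsVanish dX I i := by
  intro q x hx
  obtain ⟨y, hy⟩ := h q (f (i + 1) x) (by rw [hf]; exact map_mem_smul_top _ _ hx)
  refine ⟨g (i + 2) y - s (i + 1) x, ?_⟩
  have e : x - dX (i + 1) (g (i + 2) y - s (i + 1) x) =
      g (i + 1) (f (i + 1) x - dY (i + 1) y) - s i (dX i x) := by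
    have := hs i x
    rw [map_sub, map_sub, hg, sub_eq_iff_eq_add] at *
    rw [this]; abel
  rw [e]
  exact sub_mem (map_mem_smul_top _ _ hy)
    (map_mem_smul_top _ _ (mem_pow_smul_top_of_le q.le_succ hx))

end Complexes

/-! ### Extensions of complexes -/

section Extension

variable {R : Type*} [CommRing R] {X Y Z : ℕ → Type*}
  [∀ i, AddCommGroup (X i)] [∀ i, Module R (X i)]
  [∀ i, AddCommGroup (Y i)] [∀ i, Module R (Y i)]
  [∀ i, AddCommGroup (Z i)] [∀ i, Module R (Z i)]
  (dX : ∀ i, X (i + 1) →ₗ[R] X i) (dY : ∀ i, Y (i + 1) →ₗ[R] Y i)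
  (δ : ∀ i, Y (i + 1) →ₗ[R] X i)

/-- The differential `(x, y) ↦ (dx + δy, dy)` of an extension of the complex `Y` by `X`. -/
def extD (i : ℕ) : (X (i + 1) × Y (i + 1)) →ₗ[R] X i × Y i :=
  ((dX i).coprod (δ i)).prod (dY i ∘ₗ LinearMap.snd R _ _)

lemma extD_apply (i : ℕ) (z : X (i + 1) × Y (i + 1)) :
    extD dX dY δ i z = (dX i z.1 + δ i z.2, dY i z.2) := by
  simp [extD]

variable {dX dY δ} {I : Ideal R} {dZ : ∀ i, Z (i + 1) →ₗ[R] Z i}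

/-- The middle term, when the connecting map is zero modulo `I`. -/
lemma torMapsVanish_ext_of_connecting {i : ℕ} (hI : ∀ y, δ i y ∈ I • (⊤ : Submodule R (X i)))
    (hδ : ∀ i y, dX i (δ (i + 1) y) = -δ i (dY (i + 1) y))
    (SX : TorMapsVanish dX I i) (SY : TorMapsVanish dY I i) :
    TorMapsVanish (X := fun i => X i × Y i) (extD dX dY δ) I i := by
  intro q z hz
  rw [extD_apply, mem_smul_top_prod] at hz
  obtain ⟨y, hy⟩ := SY q z.2 hz.2
  -- This is `(dz.1 + δz.2) - δ(z.2 - dy)`. The last term is in `I ^ (q + 1)`, although `z.2 - dy`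
  -- is only in `I ^ q`, because `δ` gains a power.
  have h1 : dX i (z.1 - δ (i + 1) y) ∈ I ^ (q + 1) • (⊤ : Submodule R (X i)) := by
    have := sub_mem hz.1 (map_mem_pow_succ_smul_top hI hy)
    convert this using 1
    simp only [map_sub, hδ]
    abel
  obtain ⟨x, hx⟩ := SX q _ h1
  refine ⟨(x, y), ?_⟩
  rw [extD_apply, mem_smul_top_prod]
  refine ⟨?_, hy⟩
  convert hx using 1
  simp only [Prod.fst_sub]
  abel

/-- The right term, when the connecting map is zero modulo `I`. -/
lemma torMapsVanish_right_of_connecting {i : ℕ} (hI : ∀ y, δ i y ∈ I • (⊤ : Submodule R (X i)))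
    (hδ : ∀ i y, dX i (δ (i + 1) y) = -δ i (dY (i + 1) y))
    (SX : TorMapsVanish dX I i)
    (SG : TorMapsVanish (X := fun i => X i × Y i) (extD dX dY δ) I (i + 1)) :
    TorMapsVanish dY I (i + 1) := by
  intro q n hn
  -- Here `dδn = -δdn` lies in `I ^ (q + 2)`, so the condition applies with `q + 1`; hence `d(-m,
  -- n)` lies in `I ^ (q + 1)`.
  obtain ⟨m, hm⟩ := SX (q + 1) (δ (i + 1) n) (by
    rw [hδ]; exact neg_mem (map_mem_pow_succ_smul_top hI hn))
  obtain ⟨z, hz⟩ := SG q (-m, n) (by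
    rw [extD_apply, mem_smul_top_prod]
    refine ⟨?_, hn⟩
    convert hm using 1
    simp only [map_neg]; abel)
  rw [extD_apply, mem_smul_top_prod] at hz
  exact ⟨z.2, hz.2⟩

variable {f : ∀ i, Z i →ₗ[R] X i × Y i} {g : ∀ i, X i × Y i →ₗ[R] Z i}
  {s : ∀ i, X i × Y i →ₗ[R] X (i + 1) × Y (i + 1)}

/-- The right term, when the inclusion of the left term becomes zero modulo `I` in a homotopy
retraction `Z` of the extension. -/
lemma torMapsVanish_right_of_inl {i : ℕ}
    (hX : ∀ i x, dX i (dX (i + 1) x) = 0)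
    (hδ : ∀ i y, dX i (δ (i + 1) y) = -δ i (dY (i + 1) y))
    (hs : ∀ i x, f (i + 1) (g (i + 1) x) - x =
      extD dX dY δ (i + 1) (s (i + 1) x) + s i (extD dX dY δ i x))
    (hI : ∀ x, g (i + 1) (x, 0) ∈ I • (⊤ : Submodule R (Z (i + 1))))
    (SX : TorMapsVanish dX I i)
    (SG : TorMapsVanish (X := fun i => X i × Y i) (extD dX dY δ) I (i + 1)) :
    TorMapsVanish dY I (i + 1) := by
  intro q n hn
  have h1 : dX i (δ (i + 1) n) ∈ I ^ (q + 1) • (⊤ : Submodule R (X i)) := by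
    rw [hδ]; exact neg_mem (map_mem_smul_top _ _ hn)
  obtain ⟨m, hm⟩ := SX q _ h1
  set m' := δ (i + 1) n - dX (i + 1) m with hm'
  have h2 : extD dX dY δ i (m', 0) ∈ I ^ (q + 1) • (⊤ : Submodule R (X i × Y i)) := by
    rw [extD_apply, mem_smul_top_prod]
    simp only [map_zero, add_zero, hm', map_sub, hX, sub_zero]
    exact ⟨h1, zero_mem _⟩
  have hg : g (i + 1) (m', 0) ∈ I ^ (q + 1) • (⊤ : Submodule R (Z (i + 1))) :=
    map_mem_pow_succ_smul_top (f := g (i + 1) ∘ₗ LinearMap.inl R _ _) hI hm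
  have e := hs i (m', 0)
  -- Now `m'` is only in `I ^ q`, so `d(-m, n) = (m', dn)` is not small enough. Adding `s(m', 0)`
  -- replaces `(m', 0)` by `f g (m', 0)`, up to `s d (m', 0)`, and `g` gains the missing power. The
  -- correction itself lies in `I ^ q` and is removed at the end.
  obtain ⟨z, hz⟩ := SG q ((-m, n) + s (i + 1) (m', 0)) (by
    have e2 : extD dX dY δ (i + 1) (-m, n) = (m', 0) + (0, dY (i + 1) n) := by
      rw [extD_apply]; ext <;> simp [hm', sub_eq_neg_add]
    have e3 : extD dX dY δ (i + 1) ((-m, n) + s (i + 1) (m', 0)) =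
        f (i + 1) (g (i + 1) (m', 0)) - s i (extD dX dY δ i (m', 0)) + (0, dY (i + 1) n) := by
      rw [map_add, e2, sub_eq_iff_eq_add.1 e]; abel
    rw [e3]
    refine add_mem (sub_mem (map_mem_smul_top _ _ hg) (map_mem_smul_top _ _ h2)) ?_
    exact mem_smul_top_prod.2 ⟨zero_mem _, hn⟩)
  have hs2 : s (i + 1) (m', 0) ∈ I ^ q • (⊤ : Submodule R (X (i + 2) × Y (i + 2))) :=
    map_mem_smul_top _ _ (mem_smul_top_prod.2 ⟨hm, zero_mem _⟩)
  have := (mem_smul_top_prod.1 (sub_mem hz hs2)).2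
  refine ⟨z.2, ?_⟩
  convert this using 1
  simp only [extD_apply, Prod.snd_sub, Prod.snd_add]
  abel

/-- The left term, when the inclusion of the left term becomes zero modulo `I` in a homotopy
retraction `Z` of the extension. -/
lemma torMapsVanish_left_of_inl {i : ℕ}
    (hδ : ∀ i y, dX i (δ (i + 1) y) = -δ i (dY (i + 1) y))
    (hf : ∀ i x, extD dX dY δ i (f (i + 1) x) = f i (dZ i x))
    (hg : ∀ i x, dZ i (g (i + 1) x) = g i (extD dX dY δ i x))
    (hs : ∀ i x, f (i + 1) (g (i + 1) x) - x =
      extD dX dY δ (i + 1) (s (i + 1) x) + s i (extD dX dY δ i x))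
    (hI : ∀ x, g i (x, 0) ∈ I • (⊤ : Submodule R (Z i)))
    (SZ : TorMapsVanish dZ I i) (SY : TorMapsVanish dY I (i + 1)) :
    TorMapsVanish dX I i := by
  intro q m hm
  have ed : extD dX dY δ i (m, 0) = (dX i m, 0) := by simp [extD_apply]
  obtain ⟨p, hp⟩ := SZ (q + 1) (g (i + 1) (m, 0)) (by
    rw [hg, ed]
    exact map_mem_pow_succ_smul_top (f := g i ∘ₗ LinearMap.inl R _ _) hI hm)
  have e := hs i (m, 0)
  set w := f (i + 2) p - s (i + 1) (m, 0) with hw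
  have h1 : (m, 0) - extD dX dY δ (i + 1) w ∈
      I ^ (q + 1) • (⊤ : Submodule R (X (i + 1) × Y (i + 1))) := by
    have e2 : (m, 0) - extD dX dY δ (i + 1) w =
        f (i + 1) (g (i + 1) (m, 0) - dZ (i + 1) p) - s i (dX i m, 0) := by
      rw [hw, map_sub, map_sub, hf, sub_eq_iff_eq_add.1 e, ed]; abel
    rw [e2]
    exact sub_mem (map_mem_smul_top _ _ hp)
      (map_mem_smul_top _ _ (mem_smul_top_prod.2 ⟨hm, zero_mem _⟩))
  rw [extD_apply, mem_smul_top_prod] at h1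
  obtain ⟨n, hn⟩ := SY q w.2 (by simpa using neg_mem h1.2)
  -- The first component of `w - d(0, n)`: this change leaves `dw` unaltered and brings the second
  -- component into `I ^ q`.
  refine ⟨w.1 - δ (i + 2) n, ?_⟩
  have e3 : m - dX (i + 1) (w.1 - δ (i + 2) n) =
      (m - (dX (i + 1) w.1 + δ (i + 1) w.2)) + δ (i + 1) (w.2 - dY (i + 2) n) := by
    simp only [map_sub, hδ]; abel
  rw [e3]
  exact add_mem (mem_pow_smul_top_of_le q.le_succ h1.1) (map_mem_smul_top _ _ hn)

/-- The middle term, when the projection from `Z` to the right term is zero modulo `I`. -/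
lemma torMapsVanish_middle_of_snd {i : ℕ}
    (hδ : ∀ i y, dX i (δ (i + 1) y) = -δ i (dY (i + 1) y))
    (hf : ∀ i x, extD dX dY δ i (f (i + 1) x) = f i (dZ i x))
    (hg : ∀ i x, dZ i (g (i + 1) x) = g i (extD dX dY δ i x))
    {t : ∀ i, Z i →ₗ[R] Z (i + 1)}
    (ht : ∀ i x, g (i + 1) (f (i + 1) x) - x = dZ (i + 1) (t (i + 1) x) + t i (dZ i x))
    (hI : ∀ p, (f i p).2 ∈ I • (⊤ : Submodule R (Y i)))
    (SX : TorMapsVanish dX I i) (SY : TorMapsVanish dY I i) :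
    TorMapsVanish dZ I i := by
  intro q p hp
  -- The second component of `f` gains a power, so `n` is accurate to order `q + 1`; applying `δ` to
  -- the error then needs no further gain.
  obtain ⟨n, hn⟩ := SY (q + 1) (f (i + 1) p).2 (by
    have := congrArg Prod.snd (hf i p)
    rw [extD_apply] at this
    simp only at this
    rw [this]
    exact map_mem_pow_succ_smul_top (f := LinearMap.snd R _ _ ∘ₗ f i) hI hp)
  have h1 : dX i ((f (i + 1) p).1 - δ (i + 1) n) ∈ I ^ (q + 1) • (⊤ : Submodule R (X i)) := by
    have h2 := congrArg Prod.fst (hf i p)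
    rw [extD_apply] at h2
    simp only at h2
    have e : dX i ((f (i + 1) p).1 - δ (i + 1) n) =
        (f i (dZ i p)).1 - δ i ((f (i + 1) p).2 - dY (i + 1) n) := by
      rw [← h2]; simp only [map_sub, hδ]; abel
    rw [e]
    exact sub_mem (mem_smul_top_prod.1 (map_mem_smul_top _ (f i) hp)).1 (map_mem_smul_top _ _ hn)
  obtain ⟨m, hm⟩ := SX q _ h1
  have h3 : f (i + 1) p - extD dX dY δ (i + 1) (m, n) ∈
      I ^ q • (⊤ : Submodule R (X (i + 1) × Y (i + 1))) := by
    rw [extD_apply, mem_smul_top_prod]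
    refine ⟨?_, mem_pow_smul_top_of_le q.le_succ hn⟩
    convert hm using 1
    simp only [Prod.fst_sub]; abel
  refine ⟨g (i + 2) (m, n) - t (i + 1) p, ?_⟩
  have e : p - dZ (i + 1) (g (i + 2) (m, n) - t (i + 1) p) =
      g (i + 1) (f (i + 1) p - extD dX dY δ (i + 1) (m, n)) - t i (dZ i p) := by
    rw [map_sub, map_sub, hg, sub_eq_iff_eq_add.1 (ht i p)]; abel
  rw [e]
  exact sub_mem (map_mem_smul_top _ _ h3)
    (map_mem_smul_top _ _ (mem_pow_smul_top_of_le q.le_succ hp))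

/-- The left term, when the projection from `Z` to the right term is zero modulo `I`. -/
lemma torMapsVanish_left_of_snd {i : ℕ}
    (hX : ∀ i x, dX i (dX (i + 1) x) = 0) (hY : ∀ i y, dY i (dY (i + 1) y) = 0)
    (hδ : ∀ i y, dX i (δ (i + 1) y) = -δ i (dY (i + 1) y))
    (hs : ∀ i x, f (i + 1) (g (i + 1) x) - x =
      extD dX dY δ (i + 1) (s (i + 1) x) + s i (extD dX dY δ i x))
    (hI : ∀ p, (f (i + 1) p).2 ∈ I • (⊤ : Submodule R (Y (i + 1))))
    (SG : TorMapsVanish (X := fun i => X i × Y i) (extD dX dY δ) I i)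
    (SY : TorMapsVanish dY I (i + 1)) :
    TorMapsVanish dX I i := by
  intro q m hm
  have ed : extD dX dY δ i (m, 0) = (dX i m, 0) := by simp [extD_apply]
  have hG : ∀ z, extD dX dY δ i (extD dX dY δ (i + 1) z) = 0 := by
    intro z
    simp only [extD_apply, map_add, hX, hY, hδ]
    ext <;> simp
  obtain ⟨w, hw⟩ := SG q (m, 0) (by
    rw [ed]; exact mem_smul_top_prod.2 ⟨hm, zero_mem _⟩)
  set v := (m, 0) - extD dX dY δ (i + 1) w with hv
  have hdv : extD dX dY δ i v ∈ I ^ (q + 1) • (⊤ : Submodule R (X i × Y i)) := by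
    rw [hv, map_sub, hG, sub_zero, ed]
    exact mem_smul_top_prod.2 ⟨hm, zero_mem _⟩
  -- The new error `v'` equals `f g v - s d v`. It still lies in `I ^ q`, but its second component
  -- lies in `I ^ (q + 1)`, since the second component of `f` gains a power; thus `SY` applies to
  -- `w'.2`.
  set w' := w - s (i + 1) v with hw'
  set v' := v + extD dX dY δ (i + 1) (s (i + 1) v) with hv'
  have hv'q : v' ∈ I ^ q • (⊤ : Submodule R (X (i + 1) × Y (i + 1))) :=
    add_mem hw (map_mem_smul_top _ _ (map_mem_smul_top _ _ hw))
  have hv'2 : v'.2 ∈ I ^ (q + 1) • (⊤ : Submodule R (Y (i + 1))) := by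
    have e : v' = f (i + 1) (g (i + 1) v) - s i (extD dX dY δ i v) := by
      rw [sub_eq_iff_eq_add.1 (hs i v), hv']; abel
    rw [e]
    exact sub_mem (map_mem_pow_succ_smul_top (f := LinearMap.snd R _ _ ∘ₗ f (i + 1)) hI
      (map_mem_smul_top _ _ hw)) (mem_smul_top_prod.1 (map_mem_smul_top _ (s i) hdv)).2
  have e1 : (m, 0) - extD dX dY δ (i + 1) w' = v' := by
    rw [hw', hv', map_sub, hv]; abel
  have e2 := congrArg Prod.snd e1
  have e3 := congrArg Prod.fst e1
  simp only [extD_apply, Prod.fst_sub, Prod.snd_sub, zero_sub] at e2 e3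
  obtain ⟨n, hn⟩ := SY q w'.2 (by rw [← neg_mem_iff, e2]; exact hv'2)
  refine ⟨w'.1 - δ (i + 2) n, ?_⟩
  have e4 : m - dX (i + 1) (w'.1 - δ (i + 2) n) = v'.1 + δ (i + 1) (w'.2 - dY (i + 2) n) := by
    rw [← e3]; simp only [map_sub, hδ]; abel
  rw [e4]
  exact add_mem (mem_smul_top_prod.1 hv'q).1 (map_mem_smul_top _ _ hn)

end Extension

/-! ### The horseshoe lemma and uniqueness of resolutions -/

section Horseshoe

variable {R : Type*} [CommRing R] {X Y : ℕ → Type*}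
  [∀ i, AddCommGroup (X i)] [∀ i, Module R (X i)]
  [∀ i, AddCommGroup (Y i)] [∀ i, Module R (Y i)]
  {A B C : Type*} [AddCommGroup A] [Module R A] [AddCommGroup B] [Module R B]
  [AddCommGroup C] [Module R C]
  {dX : ∀ i, X (i + 1) →ₗ[R] X i} {εX : X 0 →ₗ[R] A}
  {dY : ∀ i, Y (i + 1) →ₗ[R] Y i} {εY : Y 0 →ₗ[R] C}
  {φ : A →ₗ[R] B} {ψ : B →ₗ[R] C}

/-- `δ` is lifted through the exact complex `X`, using projectivity of `Y`. The sign makes `extD`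
square to zero. -/
lemma exists_horseshoe [∀ i, Module.Projective R (Y i)]
    (hφ : Function.Injective φ) (h : Function.Exact φ ψ) (hψ : Function.Surjective ψ)
    (hXs : Function.Surjective εX) (hX0 : Function.Exact (dX 0) εX)
    (hX : ∀ i, Function.Exact (dX (i + 1)) (dX i))
    (hY0 : ∀ y, εY (dY 0 y) = 0) (hY : ∀ i y, dY i (dY (i + 1) y) = 0) :
    ∃ (σ : Y 0 →ₗ[R] B) (δ : ∀ i, Y (i + 1) →ₗ[R] X i),
      (∀ y, ψ (σ y) = εY y) ∧ (∀ y, φ (εX (δ 0 y)) = -σ (dY 0 y)) ∧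
      ∀ i y, dX i (δ (i + 1) y) = -δ i (dY (i + 1) y) := by
  obtain ⟨σ, hσ⟩ := exists_lift_of_range_le ψ εY fun x => hψ _
  obtain ⟨δ0, hδ0⟩ := exists_lift_of_range_le (φ ∘ₗ εX) (-(σ ∘ₗ dY 0)) fun y => by
    obtain ⟨a, ha⟩ := (h ((-(σ ∘ₗ dY 0)) y)).1 (by simp [hσ, hY0])
    obtain ⟨x, rfl⟩ := hXs a
    exact ⟨x, ha⟩
  obtain ⟨δ, h1, h2⟩ := exists_seq (α := fun i => Y (i + 1) →ₗ[R] X i)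
    (fun i δ => (∀ y, ∃ x, dX i x = -δ (dY (i + 1) y)) ∧ ∀ h : i = 0, h ▸ δ = δ0)
    (fun i δ δ' => ∀ y, dX i (δ' y) = -δ (dY (i + 1) y))
    ⟨δ0, fun y => (hX0 _).1 (hφ (by
      have := hδ0 (dY 1 y)
      simp only [LinearMap.comp_apply, LinearMap.neg_apply, hY, map_zero, neg_zero] at this
      rw [map_neg, map_neg, this, neg_zero, map_zero])), fun _ => rfl⟩
    (fun i δ hδ => by
      obtain ⟨δ', hδ'⟩ := exists_lift_of_range_le (dX i) (-(δ ∘ₗ dY (i + 1))) hδ.1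
      refine ⟨δ', ⟨fun y => (hX i _).1 ?_, fun h => absurd h (Nat.succ_ne_zero i)⟩, hδ'⟩
      rw [map_neg, hδ', LinearMap.neg_apply, LinearMap.comp_apply, hY, map_zero, neg_zero,
        neg_zero])
  have h0 : δ 0 = δ0 := (h1 0).2 rfl
  exact ⟨σ, δ, hσ, fun y => by rw [h0]; exact hδ0 y, h2⟩

variable {σ : Y 0 →ₗ[R] B} {δ : ∀ i, Y (i + 1) →ₗ[R] X i}

lemma horseshoe_surjective (h : Function.Exact φ ψ)
    (hXs : Function.Surjective εX) (hYs : Function.Surjective εY) (hσ : ∀ y, ψ (σ y) = εY y) :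
    Function.Surjective ((φ ∘ₗ εX).coprod σ) := by
  intro b
  obtain ⟨y, hy⟩ := hYs (ψ b)
  obtain ⟨a, ha⟩ := (h (b - σ y)).1 (by rw [map_sub, hσ, hy, sub_self])
  obtain ⟨x, rfl⟩ := hXs a
  exact ⟨(x, y), by simp [ha]⟩

lemma horseshoe_exact_zero (hφ : Function.Injective φ) (h : Function.Exact φ ψ)
    (hX0 : Function.Exact (dX 0) εX) (hY0 : Function.Exact (dY 0) εY)
    (hσ : ∀ y, ψ (σ y) = εY y) (hδ0 : ∀ y, φ (εX (δ 0 y)) = -σ (dY 0 y)) :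
    Function.Exact (extD dX dY δ 0) ((φ ∘ₗ εX).coprod σ) := by
  intro z
  simp only [LinearMap.coprod_apply, LinearMap.comp_apply, Set.mem_range, extD_apply]
  constructor
  · intro hz
    have h1 := congrArg ψ hz
    rw [map_add, h.apply_apply_eq_zero, zero_add, hσ, map_zero] at h1
    obtain ⟨y, hy⟩ := (hY0 _).1 h1
    obtain ⟨x, hx⟩ := (hX0 (z.1 - δ 0 y)).1 (hφ (by
      rw [map_sub, map_sub, hδ0, hy, sub_neg_eq_add, hz, map_zero]))
    exact ⟨(x, y), by ext <;> simp [hx, hy]⟩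
  · rintro ⟨w, rfl⟩
    simp [hX0.apply_apply_eq_zero, hδ0]

lemma horseshoe_exact_succ (hX : ∀ i, Function.Exact (dX (i + 1)) (dX i))
    (hY : ∀ i, Function.Exact (dY (i + 1)) (dY i))
    (hδ : ∀ i y, dX i (δ (i + 1) y) = -δ i (dY (i + 1) y)) (i : ℕ) :
    Function.Exact (extD dX dY δ (i + 1)) (extD dX dY δ i) := by
  intro z
  simp only [Set.mem_range, extD_apply, Prod.mk_eq_zero]
  constructor
  · rintro ⟨h1, h2⟩
    obtain ⟨y, hy⟩ := (hY i _).1 h2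
    obtain ⟨x, hx⟩ := (hX i (z.1 - δ (i + 1) y)).1 (by
      rw [map_sub, hδ, hy, sub_neg_eq_add, h1])
    exact ⟨(x, y), by ext <;> simp [hx, hy]⟩
  · rintro ⟨w, rfl⟩
    simp [(hX i).apply_apply_eq_zero, (hY i).apply_apply_eq_zero, hδ]

end Horseshoe

section HomotopyEquiv

variable {R : Type*} [CommRing R] {X Y : ℕ → Type*}
  [∀ i, AddCommGroup (X i)] [∀ i, Module R (X i)]
  [∀ i, AddCommGroup (Y i)] [∀ i, Module R (Y i)]
  {A : Type*} [AddCommGroup A] [Module R A]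
  {dX : ∀ i, X (i + 1) →ₗ[R] X i} {εX : X 0 →ₗ[R] A}
  {dY : ∀ i, Y (i + 1) →ₗ[R] Y i} {εY : Y 0 →ₗ[R] A}

/-- Both composites lift the identity, hence are homotopic to it. The homotopy identities are
recorded in positive degrees only, where `TorMapsVanish` lives. -/
lemma exists_homotopyEquiv [∀ i, Module.Projective R (X i)] [∀ i, Module.Projective R (Y i)]
    (hXs : Function.Surjective εX) (hX0 : Function.Exact (dX 0) εX)
    (hX : ∀ i, Function.Exact (dX (i + 1)) (dX i))
    (hYs : Function.Surjective εY) (hY0 : Function.Exact (dY 0) εY)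
    (hY : ∀ i, Function.Exact (dY (i + 1)) (dY i)) :
    ∃ (f : ∀ i, X i →ₗ[R] Y i) (g : ∀ i, Y i →ₗ[R] X i)
      (s : ∀ i, Y i →ₗ[R] Y (i + 1)) (t : ∀ i, X i →ₗ[R] X (i + 1)),
      (∀ x, εY (f 0 x) = εX x) ∧ (∀ i x, dY i (f (i + 1) x) = f i (dX i x)) ∧
      (∀ y, εX (g 0 y) = εY y) ∧ (∀ i y, dX i (g (i + 1) y) = g i (dY i y)) ∧
      (∀ i y, f (i + 1) (g (i + 1) y) - y = dY (i + 1) (s (i + 1) y) + s i (dY i y)) ∧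
      ∀ i x, g (i + 1) (f (i + 1) x) - x = dX (i + 1) (t (i + 1) x) + t i (dX i x) := by
  have hXz : ∀ i x, dX i (dX (i + 1) x) = 0 := fun i x => (hX i).apply_apply_eq_zero x
  have hYz : ∀ i x, dY i (dY (i + 1) x) = 0 := fun i x => (hY i).apply_apply_eq_zero x
  obtain ⟨f, hf0, hf⟩ := exists_chainMap dX εX dY εY hX0.apply_apply_eq_zero hXz hYs hY0 hY
    LinearMap.id
  obtain ⟨g, hg0, hg⟩ := exists_chainMap dY εY dX εX hY0.apply_apply_eq_zero hYz hXs hX0 hX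
    LinearMap.id
  simp only [LinearMap.id_apply] at hf0 hg0
  obtain ⟨s, hs⟩ := exists_homotopy_zero dY dY εY hYz hY0 hY
    (fun i => f i ∘ₗ g i - LinearMap.id) (fun y => by simp [hf0, hg0])
    (fun i y => by simp [hf, hg])
  obtain ⟨t, ht⟩ := exists_homotopy_zero dX dX εX hXz hX0 hX
    (fun i => g i ∘ₗ f i - LinearMap.id) (fun y => by simp [hf0, hg0])
    (fun i y => by simp [hf, hg])
  exact ⟨f, g, s, t, hf0, hf, hg0, hg, hs, ht⟩

end HomotopyEquiv

/-! ### The defect of a minimal free resolution -/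

namespace MinimalFreeResolution

variable {R : Type u} [CommRing R] {I : Ideal R} {M : Type u} [AddCommGroup M] [Module R M]
  (F : MinimalFreeResolution I M)

lemma d_d (i : ℕ) (x : Fin (F.rank (i + 2)) → R) : F.d i (F.d (i + 1) x) = 0 :=
  (F.exact_succ i).apply_apply_eq_zero x

/-- The maps `Torᵢ₊₁(R / I ^ (q + 1), M) → Torᵢ₊₁(R / I ^ q, M)` are zero for all `q`. -/
abbrev TorMapsVanish (i : ℕ) : Prop :=
  LinDefect.TorMapsVanish (X := fun i => Fin (F.rank i) → R) F.d I i

lemma grMk_eq_zero_iff {n i : ℕ} (x : F.filtration n i) :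
    F.grMk n i x = 0 ↔ x.1 ∈ F.filtration (n + 1) i := by
  exact Submodule.Quotient.mk_eq_zero _

lemma exact_grD_iff (n i : ℕ) : Function.Exact (F.grD n (i + 1)) (F.grD n i) ↔
    ∀ x ∈ F.filtration n (i + 1), F.d i x ∈ F.filtration (n + 1) i →
      ∃ y ∈ F.filtration n (i + 2), x - F.d (i + 1) y ∈ F.filtration (n + 1) (i + 1) := by
  have key (x : F.filtration n (i + 1)) :
      F.grD n i (F.grMk n (i + 1) x) = 0 ↔ F.d i x.1 ∈ F.filtration (n + 1) i := by
    rw [grD_grMk, grMk_eq_zero_iff]; rfl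
  have key2 (x : F.filtration n (i + 1)) (y : F.filtration n (i + 2)) :
      F.grD n (i + 1) (F.grMk n (i + 2) y) = F.grMk n (i + 1) x ↔
        x.1 - F.d (i + 1) y.1 ∈ F.filtration (n + 1) (i + 1) := by
    rw [grD_grMk, eq_comm, ← sub_eq_zero, ← map_sub, grMk_eq_zero_iff]; rfl
  constructor
  · intro h x hx hdx
    obtain ⟨y, hy⟩ := (h (F.grMk n (i + 1) ⟨x, hx⟩)).1 ((key _).2 hdx)
    obtain ⟨y, rfl⟩ := F.grMk_surjective _ _ y
    exact ⟨y.1, y.2, (key2 _ _).1 hy⟩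
  · intro h x
    obtain ⟨x, rfl⟩ := F.grMk_surjective _ _ x
    rw [key]
    constructor
    · intro hdx
      obtain ⟨y, hy, hxy⟩ := h x.1 x.2 hdx
      exact ⟨F.grMk n (i + 2) ⟨y, hy⟩, (key2 _ _).2 hxy⟩
    · rintro ⟨y, hy⟩
      rw [← key, ← hy]
      exact LinearMap.congr_fun (F.grD_comp_grD n i) y

/-- A direct sum of complexes is exact if and only if each summand is. Degree `0` is left out
because it contributes only `0` to the supremum defining the defect. -/
lemma isZero_homology_linearPart_iff (i : ℕ) : Limits.IsZero (F.linearPart.homology (i + 1)) ↔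
    ∀ n, Function.Exact (F.grD n (i + 1)) (F.grD n i) := by
  rw [← HomologicalComplex.exactAt_iff_isZero_homology,
    HomologicalComplex.exactAt_iff' _ (i + 2) (i + 1) i (by simp) (by simp),
    ShortComplex.ShortExact.moduleCat_exact_iff_function_exact]
  have e1 : F.linearPart.d (i + 2) (i + 1) =
      ModuleCat.ofHom (DirectSum.lmap fun n => F.grD n (i + 1)) := ChainComplex.of_d
        (X := fun i => ModuleCat.of R (⨁ n, F.grPiece n i))
        (d := fun i => ModuleCat.ofHom (DirectSum.lmap fun n => F.grD n i)) (j := i + 1)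
  have e2 : F.linearPart.d (i + 1) i =
      ModuleCat.ofHom (DirectSum.lmap fun n => F.grD n i) := ChainComplex.of_d
        (X := fun i => ModuleCat.of R (⨁ n, F.grPiece n i))
        (d := fun i => ModuleCat.ofHom (DirectSum.lmap fun n => F.grD n i)) (j := i)
  have e : Function.Exact (F.linearPart.d (i + 2) (i + 1)).hom (F.linearPart.d (i + 1) i).hom ↔
      Function.Exact (DirectSum.lmap fun n => F.grD n (i + 1))
        (DirectSum.lmap fun n => F.grD n i) := by
    rw [e1, e2]; rfl
  refine e.trans ?_
  simp only [LinearMap.exact_iff, DirectSum.ker_lmap, DirectSum.range_lmap]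
  constructor
  · intro h n
    ext x
    have := SetLike.ext_iff.1 h (DirectSum.lof R ℕ (fun n => F.grPiece n (i + 1)) n x)
    simp only [Submodule.mem_comap, Submodule.mem_pi, Set.mem_univ, true_imp_iff,
      DirectSum.coeFnLinearMap_apply] at this
    constructor
    · intro hx
      have := this.1 fun m => ?_
      · simpa [DirectSum.lof_apply] using this n
      · by_cases hm : m = n
        · subst hm; simpa [DirectSum.lof_apply] using hx
        · rw [DirectSum.lof_eq_of, DirectSum.of_eq_of_ne _ _ _ hm]; exact zero_mem _
    · intro hx
      have := this.2 fun m => ?_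
      · simpa [DirectSum.lof_apply] using this n
      · by_cases hm : m = n
        · subst hm; simpa [DirectSum.lof_apply] using hx
        · rw [DirectSum.lof_eq_of, DirectSum.of_eq_of_ne _ _ _ hm]; exact zero_mem _
  · intro h
    simp only [h]

/-- Exactness of the linear part improves `x - dy` by one power of `I` at a time, by successively
correcting `y`, until the power `q` is reached. -/
lemma torMapsVanish_of_isZero {i : ℕ} (h : Limits.IsZero (F.linearPart.homology (i + 1))) :
    F.TorMapsVanish i := by
  rw [isZero_homology_linearPart_iff] at h
  intro q x hx
  suffices ∀ p ≤ q, ∃ y : Fin (F.rank (i + 2)) → R, x - F.d (i + 1) y ∈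
      I ^ p • (⊤ : Submodule R (Fin (F.rank (i + 1)) → R)) from this q le_rfl
  intro p hp
  induction p with
  | zero => exact ⟨0, mem_pow_zero_smul_top I _⟩
  | succ p ih =>
    obtain ⟨y, hy⟩ := ih (by omega)
    -- In filtration level `p + (i + 1)` an element of degree `i + 1` lies in `I ^ p`, and the cycle
    -- condition asks for `dx ∈ I ^ (p + 2)`; this holds because `p + 1 ≤ q`.
    obtain ⟨z, -, hz⟩ := (F.exact_grD_iff (p + (i + 1)) i).1 (h _) (x - F.d (i + 1) y)
      (by rwa [filtration, Nat.add_sub_cancel])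
      (by
        rw [map_sub, d_d, sub_zero, filtration]
        exact mem_pow_smul_top_of_le (by omega) hx)
    refine ⟨y + z, ?_⟩
    rw [filtration, show p + (i + 1) + 1 - (i + 1) = p + 1 by omega] at hz
    rwa [map_add, ← sub_sub]

/-- The vanishing in index `i` makes a cycle of the linear part a boundary `dy` to the right order,
but with no control of `y`. The vanishing in index `i + 1` moves `y` by a boundary into the required
power of `I`. -/
lemma isZero_of_torMapsVanish {i : ℕ} (h0 : F.TorMapsVanish i)
    (h1 : F.TorMapsVanish (i + 1)) : Limits.IsZero (F.linearPart.homology (i + 1)) := by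
  rw [isZero_homology_linearPart_iff]
  intro n
  rw [exact_grD_iff]
  intro x hx hdx
  unfold filtration at *
  rcases Nat.lt_or_ge i n with hn | hn
  · obtain ⟨p, rfl⟩ := Nat.exists_eq_add_of_lt hn
    rw [show i + p + 1 - (i + 1) = p by omega] at hx
    rw [show i + p + 1 + 1 - i = p + 1 + 1 by omega] at hdx
    rw [show i + p + 1 - (i + 2) = p - 1 by omega,
      show i + p + 1 + 1 - (i + 1) = p + 1 by omega]
    obtain ⟨y, hy⟩ := h0 _ x hdx
    rcases p with _ | p
    · exact ⟨y, mem_pow_zero_smul_top I _, hy⟩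
    · obtain ⟨w, hw⟩ := h1 p y (by
        have := sub_mem hx (mem_pow_smul_top_of_le (Nat.le_succ _) hy)
        rwa [sub_sub_cancel] at this)
      exact ⟨_, hw, by rwa [map_sub, d_d, sub_zero]⟩
  -- For `n ≤ i` both exponents in degree `i + 1` truncate to `0`, so the graded piece is zero.
  · exact ⟨0, zero_mem _, by
      rw [show n + 1 - (i + 1) = 0 by omega]; exact mem_pow_zero_smul_top I _⟩

lemma torMapsVanish_of_defect_le {i : ℕ} (h : F.defect ≤ i) : F.TorMapsVanish i := by
  apply F.torMapsVanish_of_isZero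
  by_contra hz
  have : ((i + 1 : ℕ) : ℕ∞) ≤ F.defect := le_iSup₂_of_le (i + 1) hz le_rfl
  have := this.trans h
  rw [Nat.cast_le] at this
  omega

lemma defect_le {D : ℕ∞} (h : ∀ i : ℕ, D ≤ i → F.TorMapsVanish i) : F.defect ≤ D := by
  refine iSup₂_le fun i hi => ?_
  rcases i with _ | i
  · exact zero_le
  · by_contra hD
    have hD : D ≤ i := by
      rw [not_le, Nat.cast_add, Nat.cast_one] at hD
      exact Order.le_of_lt_add_one hD
    exact hi (F.isZero_of_torMapsVanish (h i hD)
      (h (i + 1) (hD.trans (Nat.cast_le.2 i.le_succ))))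

end MinimalFreeResolution

/-! ### Tor and minimal free resolutions -/

section TorComputation

variable {R : Type u} [CommRing R] (I : Ideal R)
  {A B C : Type u} [AddCommGroup A] [Module R A] [AddCommGroup B] [Module R B]
  [AddCommGroup C] [Module R C]

lemma iso_hom_comp_comp_inv_eq_zero_iff {𝒞 : Type*} [Category 𝒞] [Limits.HasZeroMorphisms 𝒞]
    {W X Y Z : 𝒞} (e : W ≅ X) (f : X ⟶ Y) (e' : Z ≅ Y) : e.hom ≫ f ≫ e'.inv = 0 ↔ f = 0 := by
  rw [← cancel_epi e.hom, ← cancel_mono e'.inv, Category.assoc, Limits.comp_zero,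
    Limits.zero_comp]

/-- The map `Q ⊗ A → Q ⊗ B` of complexes, where `Q` is the chosen projective resolution of
`R / I`. -/
abbrev tensorComplexMap (φ : A →ₗ[R] B) :=
  (NatTrans.mapHomologicalComplex ((tensoringRight (ModuleCat.{u} R)).map (ModuleCat.ofHom φ))
    (ComplexShape.down ℕ)).app (projectiveResolution (resMod I)).complex

lemma torMap_eq_zero_iff (i : ℕ) (φ : A →ₗ[R] B) :
    torMap I i φ = 0 ↔ HomologicalComplex.homologyMap (tensorComplexMap I φ) i = 0 := by
  have e : torMap I i φ =
      ((projectiveResolution (resMod I)).isoLeftDerivedObj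
        ((tensoringRight (ModuleCat.{u} R)).obj (ModuleCat.of R A)) i).hom ≫
      HomologicalComplex.homologyMap (tensorComplexMap I φ) i ≫
      ((projectiveResolution (resMod I)).isoLeftDerivedObj
        ((tensoringRight (ModuleCat.{u} R)).obj (ModuleCat.of R B)) i).inv :=
    (projectiveResolution (resMod I)).leftDerived_app_eq
      ((tensoringRight (ModuleCat.{u} R)).map (ModuleCat.ofHom φ)) i
  rw [e]
  exact iso_hom_comp_comp_inv_eq_zero_iff _ _ _

lemma torConnecting_eq_zero_iff (φ : A →ₗ[R] B) (ψ : B →ₗ[R] C)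
    (hφ : Function.Injective φ) (h : Function.Exact φ ψ) (hψ : Function.Surjective ψ) (i : ℕ) :
    torConnecting I φ ψ hφ h hψ i = 0 ↔
      (tensorSequence_shortExact φ ψ hφ h hψ (projectiveResolution (resMod I)).complex).δ
        (i + 1) i rfl = 0 :=
  iso_hom_comp_comp_inv_eq_zero_iff
    ((projectiveResolution (resMod I)).isoLeftDerivedObj _ (i + 1)) _
    ((projectiveResolution (resMod I)).isoLeftDerivedObj _ i)

/-- In degree `0` the homology is naturally `(R / I) ⊗ A`, which is `A / IA`. -/
lemma homologyMap_tensorComplexMap_zero_eq_zero_iff (φ : A →ₗ[R] B) :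
    HomologicalComplex.homologyMap (tensorComplexMap I φ) 0 = 0 ↔
      ∀ a, φ a ∈ I • (⊤ : Submodule R B) := by
  let Q := projectiveResolution (resMod I)
  let FA := (tensoringRight (ModuleCat.{u} R)).obj (ModuleCat.of R A)
  let FB := (tensoringRight (ModuleCat.{u} R)).obj (ModuleCat.of R B)
  let α : FA ⟶ FB := (tensoringRight (ModuleCat.{u} R)).map (ModuleCat.ofHom φ)
  have nat : HomologicalComplex.homologyMap (tensorComplexMap I φ) 0 ≫
      HomologicalComplex.homologyι _ 0 ≫ Q.fromLeftDerivedZero' FB =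
      HomologicalComplex.homologyι _ 0 ≫ Q.fromLeftDerivedZero' FA ≫ α.app (resMod I) := by
    have h1 : HomologicalComplex.opcyclesMap (tensorComplexMap I φ) 0 ≫
        Q.fromLeftDerivedZero' FB = Q.fromLeftDerivedZero' FA ≫ α.app (resMod I) := by
      rw [← cancel_epi (HomologicalComplex.pOpcycles _ 0)]
      rw [HomologicalComplex.p_opcyclesMap_assoc,
        ProjectiveResolution.pOpcycles_comp_fromLeftDerivedZero',
        ProjectiveResolution.pOpcycles_comp_fromLeftDerivedZero'_assoc]
      exact (α.naturality (Q.π.f 0)).symm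
    rw [← h1, HomologicalComplex.homologyι_naturality_assoc]
  have hα : HomologicalComplex.homologyMap (tensorComplexMap I φ) 0 = 0 ↔
      α.app (resMod I) = 0 := by
    constructor
    · intro h
      rw [h, Limits.zero_comp] at nat
      have : IsIso (HomologicalComplex.homologyι
        ((FA.mapHomologicalComplex (ComplexShape.down ℕ)).obj Q.complex) 0) := inferInstance
      have : IsIso (Q.fromLeftDerivedZero' FA) := inferInstance
      rw [← cancel_epi (Q.fromLeftDerivedZero' FA), ← cancel_epi (HomologicalComplex.homologyι
        ((FA.mapHomologicalComplex (ComplexShape.down ℕ)).obj Q.complex) 0), ← nat]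
      simp
    · intro h
      rw [h, Limits.comp_zero, Limits.comp_zero] at nat
      rw [← cancel_mono (HomologicalComplex.homologyι _ 0 ≫ Q.fromLeftDerivedZero' FB), nat]
      simp
  rw [hα]
  have e : α.app (resMod I) = 0 ↔ φ.lTensor (R ⧸ I) = 0 := by
    rw [ModuleCat.hom_ext_iff]; rfl
  rw [e]
  have key (x : A) : TensorProduct.quotTensorEquivQuotSMul B I (φ.lTensor (R ⧸ I) (1 ⊗ₜ x)) = 0 ↔
      φ x ∈ I • (⊤ : Submodule R B) := by
    rw [LinearMap.lTensor_tmul, TensorProduct.quotTensorEquivQuotSMul_mk_one_tmul,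
      Submodule.Quotient.mk_eq_zero]
  constructor
  · intro h a
    rw [← key, h]; simp
  · intro h
    refine TensorProduct.ext' fun r x => ?_
    obtain ⟨r, rfl⟩ := Ideal.Quotient.mk_surjective r
    rw [LinearMap.zero_apply]
    apply (TensorProduct.quotTensorEquivQuotSMul B I).injective
    rw [LinearMap.lTensor_tmul, TensorProduct.quotTensorEquivQuotSMul_mk_tmul, map_zero,
      Submodule.Quotient.mk_eq_zero, ← map_smul]
    exact h _

lemma homology_tensor_isZero_of_flat [Module.Flat R A] (i : ℕ) :
    Limits.IsZero (((((tensoringRight (ModuleCat.{u} R)).obj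
      (ModuleCat.of R A)).mapHomologicalComplex (ComplexShape.down ℕ)).obj
        (projectiveResolution (resMod I)).complex).homology (i + 1)) := by
  rw [← HomologicalComplex.exactAt_iff_isZero_homology,
    HomologicalComplex.exactAt_iff' _ (i + 2) (i + 1) i (by simp) (by simp),
    ShortComplex.ShortExact.moduleCat_exact_iff_function_exact]
  have h := (projectiveResolution (resMod I)).complex_exactAt_succ i
  rw [HomologicalComplex.exactAt_iff' _ (i + 2) (i + 1) i (by simp) (by simp),
    ShortComplex.ShortExact.moduleCat_exact_iff_function_exact] at h
  exact Module.Flat.rTensor_exact A h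

/-- By the long exact sequence it suffices that `Torᵢ(K) → Torᵢ(L)` is zero: for `i = 0` because `K`
lands in `IL`, for `i > 0` because `L` is flat. -/
lemma epi_δ_of_flat {K L N : Type u} [AddCommGroup K] [Module R K] [AddCommGroup L] [Module R L]
    [AddCommGroup N] [Module R N] [Module.Flat R L] (φ : K →ₗ[R] L) (ψ : L →ₗ[R] N)
    (hφ : Function.Injective φ) (h : Function.Exact φ ψ) (hψ : Function.Surjective ψ)
    (hI : ∀ x, φ x ∈ I • (⊤ : Submodule R L)) (i : ℕ) :
    Epi ((tensorSequence_shortExact φ ψ hφ h hψ (projectiveResolution (resMod I)).complex).δ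
        (i + 1) i rfl) := by
  have hS := tensorSequence_shortExact φ ψ hφ h hψ (projectiveResolution (resMod I)).complex
  refine (ShortComplex.exact_iff_epi _ ?_).1 (hS.homology_exact₁ (i + 1) i rfl)
  change HomologicalComplex.homologyMap (tensorComplexMap I φ) i = 0
  rcases i with _ | i
  · exact (homologyMap_tensorComplexMap_zero_eq_zero_iff I φ).2 hI
  · exact (homology_tensor_isZero_of_flat (A := L) I i).eq_of_tgt _ _

/-- The connecting maps commute with morphisms of short exact sequences of modules. -/
lemma δ_naturality {A' B' C' : Type u} [AddCommGroup A'] [Module R A'] [AddCommGroup B']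
    [Module R B'] [AddCommGroup C'] [Module R C'] (φ : A →ₗ[R] B) (ψ : B →ₗ[R] C)
    (hφ : Function.Injective φ) (h : Function.Exact φ ψ) (hψ : Function.Surjective ψ)
    (φ' : A' →ₗ[R] B') (ψ' : B' →ₗ[R] C')
    (hφ' : Function.Injective φ') (h' : Function.Exact φ' ψ') (hψ' : Function.Surjective ψ')
    (a : A →ₗ[R] A') (b : B →ₗ[R] B') (c : C →ₗ[R] C')
    (hab : ∀ x, φ' (a x) = b (φ x)) (hbc : ∀ x, ψ' (b x) = c (ψ x)) (i : ℕ) :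
    (tensorSequence_shortExact φ ψ hφ h hψ (projectiveResolution (resMod I)).complex).δ
        (i + 1) i rfl ≫ HomologicalComplex.homologyMap (tensorComplexMap I a) i =
      HomologicalComplex.homologyMap (tensorComplexMap I c) (i + 1) ≫
      (tensorSequence_shortExact φ' ψ' hφ' h' hψ' (projectiveResolution (resMod I)).complex).δ
        (i + 1) i rfl := by
  have hab' : φ' ∘ₗ a = b ∘ₗ φ := LinearMap.ext hab
  have hbc' : ψ' ∘ₗ b = c ∘ₗ ψ := LinearMap.ext hbc
  let Φ : tensorSequence φ ψ h (projectiveResolution (resMod I)).complex ⟶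
      tensorSequence φ' ψ' h' (projectiveResolution (resMod I)).complex :=
    { τ₁ := tensorComplexMap I a
      τ₂ := tensorComplexMap I b
      τ₃ := tensorComplexMap I c
      comm₁₂ := by
        ext1 n
        change _ ◁ ModuleCat.ofHom a ≫ _ ◁ ModuleCat.ofHom φ' =
          _ ◁ ModuleCat.ofHom φ ≫ _ ◁ ModuleCat.ofHom b
        rw [← MonoidalCategory.whiskerLeft_comp, ← MonoidalCategory.whiskerLeft_comp,
          ← ModuleCat.ofHom_comp, ← ModuleCat.ofHom_comp, hab']
      comm₂₃ := by
        ext1 n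
        change _ ◁ ModuleCat.ofHom b ≫ _ ◁ ModuleCat.ofHom ψ' =
          _ ◁ ModuleCat.ofHom ψ ≫ _ ◁ ModuleCat.ofHom c
        rw [← MonoidalCategory.whiskerLeft_comp, ← MonoidalCategory.whiskerLeft_comp,
          ← ModuleCat.ofHom_comp, ← ModuleCat.ofHom_comp, hbc'] }
  exact HomologicalComplex.HomologySequence.δ_naturality Φ _ _ (i + 1) i rfl

end TorComputation

/-! ### Vanishing on Tor as containment in `I`, and the bounds for given minimal resolutions -/

section

variable {R : Type u} [CommRing R] {I : Ideal R}

/-- The minimal free resolution of the first syzygy module of `M` obtained from one of `M`. -/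
def MinimalFreeResolution.shift {M : Type u} [AddCommGroup M] [Module R M]
    (F : MinimalFreeResolution I M) : MinimalFreeResolution I (LinearMap.ker F.ε) where
  rank i := F.rank (i + 1)
  d i := F.d (i + 1)
  ε := (F.d 0).codRestrict _ F.exact_zero.apply_apply_eq_zero
  ε_surjective := fun ⟨x, hx⟩ => by
    obtain ⟨y, hy⟩ := (F.exact_zero x).1 hx
    exact ⟨y, Subtype.ext hy⟩
  exact_zero := fun x => by
    rw [← F.exact_succ 0 x, ← Subtype.coe_inj]
    rfl
  exact_succ i := F.exact_succ (i + 1)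
  minimal i := F.minimal (i + 1)

lemma MinimalFreeResolution.ker_ε_le {M : Type u} [AddCommGroup M] [Module R M]
    (F : MinimalFreeResolution I M) (x : LinearMap.ker F.ε) :
    (LinearMap.ker F.ε).subtype x ∈ I • (⊤ : Submodule R (Fin (F.rank 0) → R)) := by
  obtain ⟨y, hy⟩ := (F.exact_zero x.1).1 x.2
  exact F.minimal 0 ⟨y, hy⟩

/-- Dimension shifting: `Torᵢ₊₁` of `M` maps onto `Torᵢ` of its first syzygy, so vanishing descends
to the syzygy. -/
lemma MinimalFreeResolution.eq_zero_of_δ_comp_eq_zero {M : Type u} [AddCommGroup M] [Module R M]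
    (F : MinimalFreeResolution I M) (i : ℕ) {Z : ModuleCat.{u} R} (f : _ ⟶ Z)
    (hf : (tensorSequence_shortExact (LinearMap.ker F.ε).subtype F.ε
      (Submodule.subtype_injective _) (LinearMap.exact_subtype_ker_map _) F.ε_surjective
      (projectiveResolution (resMod I)).complex).δ (i + 1) i rfl ≫ f = 0) : f = 0 := by
  have := epi_δ_of_flat I _ _ (Submodule.subtype_injective _)
    (LinearMap.exact_subtype_ker_map _) F.ε_surjective F.ker_ε_le i
  exact (cancel_epi _).1 (hf.trans Limits.comp_zero.symm)

/-- If `Torⱼ(R / I, φ)` is zero, then a lift of `φ` to minimal free resolutions is zero modulo `I`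
in degree `j`. -/
lemma lift_mem_of_torMap_eq_zero (j : ℕ) {A B : Type u} [AddCommGroup A] [Module R A]
    [AddCommGroup B] [Module R B] (F : MinimalFreeResolution I A) (G : MinimalFreeResolution I B)
    (φ : A →ₗ[R] B) (f : ∀ i, (Fin (F.rank i) → R) →ₗ[R] (Fin (G.rank i) → R))
    (hf0 : ∀ x, G.ε (f 0 x) = φ (F.ε x)) (hf : ∀ i x, G.d i (f (i + 1) x) = f i (F.d i x))
    (hφ : torMap I j φ = 0) (x : Fin (F.rank j) → R) :
    f j x ∈ I • (⊤ : Submodule R (Fin (G.rank j) → R)) := by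
  induction j generalizing A B with
  | zero =>
    rw [torMap_eq_zero_iff, homologyMap_tensorComplexMap_zero_eq_zero_iff] at hφ
    -- `f 0 x` agrees with an element of `I G₀` up to the kernel of `G.ε`, and by minimality that
    -- kernel is itself inside `I G₀`.
    have h := hφ (F.ε x)
    rw [← hf0, ← LinearMap.range_eq_top.2 G.ε_surjective, LinearMap.range_eq_map,
      ← Submodule.map_smul''] at h
    obtain ⟨y, hy, hxy⟩ := h
    obtain ⟨z, hz⟩ := (G.exact_zero (f 0 x - y)).1 (by rw [map_sub, hxy, sub_self])
    rw [← sub_add_cancel (f 0 x) y, ← hz]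
    exact add_mem (G.minimal 0 ⟨z, rfl⟩) hy
  | succ j ih =>
    have hker : ∀ y ∈ LinearMap.ker F.ε, f 0 y ∈ LinearMap.ker G.ε := fun y hy => by
      rw [LinearMap.mem_ker, hf0, LinearMap.mem_ker.1 hy, map_zero]
    refine ih F.shift G.shift ((f 0).restrict hker) (fun i => f (i + 1))
      (fun y => Subtype.ext (hf 0 y)) (fun i => hf (i + 1)) ?_ x
    rw [torMap_eq_zero_iff] at hφ ⊢
    have nat := δ_naturality I (LinearMap.ker F.ε).subtype F.ε
      (Submodule.subtype_injective _) (LinearMap.exact_subtype_ker_map _) F.ε_surjective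
      (LinearMap.ker G.ε).subtype G.ε
      (Submodule.subtype_injective _) (LinearMap.exact_subtype_ker_map _) G.ε_surjective
      ((f 0).restrict hker) (f 0) φ (fun _ => rfl) hf0 j
    rw [hφ] at nat
    exact F.eq_zero_of_δ_comp_eq_zero j _ (nat.trans Limits.zero_comp)

variable {M P N : Type u} [AddCommGroup M] [Module R M] [AddCommGroup P] [Module R P]
  [AddCommGroup N] [Module R N] {φ : M →ₗ[R] P} {ψ : P →ₗ[R] N}

/-- If the connecting map `Torⱼ₊₁(R / I, N) → Torⱼ(R / I, M)` is zero, then the corresponding map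
of minimal free resolutions is zero modulo `I`. -/
lemma connecting_mem_of_torConnecting_eq_zero
    (hφ : Function.Injective φ) (h : Function.Exact φ ψ) (hψ : Function.Surjective ψ)
    (FM : MinimalFreeResolution I M) (FN : MinimalFreeResolution I N)
    (σ : (Fin (FN.rank 0) → R) →ₗ[R] P)
    (δ : ∀ i, (Fin (FN.rank (i + 1)) → R) →ₗ[R] (Fin (FM.rank i) → R))
    (hσ : ∀ y, ψ (σ y) = FN.ε y) (hδ0 : ∀ y, φ (FM.ε (δ 0 y)) = -σ (FN.d 0 y))
    (hδ : ∀ i y, FM.d i (δ (i + 1) y) = -δ i (FN.d (i + 1) y)) {j : ℕ}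
    (hj : torConnecting I φ ψ hφ h hψ j = 0) (y : Fin (FN.rank (j + 1)) → R) :
    δ j y ∈ I • (⊤ : Submodule R (Fin (FM.rank j) → R)) := by
  have hr : ∀ k : LinearMap.ker FN.ε, (σ ∘ₗ (LinearMap.ker FN.ε).subtype) k ∈ LinearMap.range φ :=
    fun k => (h _).1 (by
      rw [LinearMap.comp_apply, Submodule.subtype_apply, hσ]; exact k.2)
  -- `c`, `σ` and the identity of `N` form a morphism from the syzygy sequence of `N` to the given
  -- one, so `Tor(c)` after the syzygy connecting map is the given connecting map.
  let c : LinearMap.ker FN.ε →ₗ[R] M := (LinearEquiv.ofInjective φ hφ).symm.toLinearMap ∘ₗ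
    (σ ∘ₗ (LinearMap.ker FN.ε).subtype).codRestrict (LinearMap.range φ) hr
  have hc : ∀ k, φ (c k) = σ k := fun k =>
    congrArg Subtype.val ((LinearEquiv.ofInjective φ hφ).apply_symm_apply
      ((σ ∘ₗ (LinearMap.ker FN.ε).subtype).codRestrict (LinearMap.range φ) hr k))
  have hc0 : torMap I j c = 0 := by
    rw [torMap_eq_zero_iff]
    rw [torConnecting_eq_zero_iff] at hj
    have nat := δ_naturality I (LinearMap.ker FN.ε).subtype FN.ε
      (Submodule.subtype_injective _) (LinearMap.exact_subtype_ker_map _) FN.ε_surjective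
      φ ψ hφ h hψ c σ LinearMap.id hc hσ j
    rw [hj] at nat
    exact FN.eq_zero_of_δ_comp_eq_zero j _ (nat.trans Limits.comp_zero)
  -- `δ` anticommutes with the differentials; the signs `(-1) ^ (i + 1)` turn it into a chain map
  -- lifting `c` on the shifted resolution.
  have h0 (y : Fin (FN.rank 1) → R) : φ (FM.ε (((-1 : R) ^ (0 + 1) • δ 0) y)) = σ (FN.d 0 y) := by
    rw [LinearMap.smul_apply, map_smul, map_smul, hδ0, pow_succ, pow_zero, one_mul, neg_smul,
      one_smul, neg_neg]
  have h1 (i : ℕ) (y : Fin (FN.rank (i + 2)) → R) :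
      FM.d i (((-1 : R) ^ (i + 1 + 1) • δ (i + 1)) y) =
        ((-1 : R) ^ (i + 1) • δ i) (FN.d (i + 1) y) := by
    rw [LinearMap.smul_apply, map_smul, hδ, smul_neg, LinearMap.smul_apply, pow_succ, mul_neg_one,
      neg_smul, neg_neg]
  have key : ((-1 : R) ^ (j + 1) • δ j) y ∈ I • (⊤ : Submodule R (Fin (FM.rank j) → R)) :=
    lift_mem_of_torMap_eq_zero j FN.shift FM c (fun i => (-1 : R) ^ (i + 1) • δ i)
      (fun y => hφ ((h0 y).trans (hc (FN.shift.ε y)).symm)) h1 hc0 y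
  have h2 := Submodule.smul_mem _ ((-1 : R) ^ (j + 1)) key
  rwa [LinearMap.smul_apply, smul_smul, ← mul_pow, neg_one_mul, neg_neg, one_pow, one_smul] at h2

lemma of_infIndex_le {p : ℕ → Prop} {i : ℕ} (h : infIndex p ≤ i) : p i := by
  by_contra hp
  have : ((i + 1 : ℕ) : ℕ∞) ≤ infIndex p := le_iInf₂ fun m hm => by
    rw [Nat.cast_le, Nat.succ_le_iff]
    by_contra hmi
    exact hp (hm i (not_lt.1 hmi))
  have := this.trans h
  rw [Nat.cast_le] at this
  omega

/-- The bounds on the linearity defects along a short exact sequence, in terms of arbitrary minimal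
free resolutions. -/
theorem defect_le_of_shortExact
    (hφ : Function.Injective φ) (h : Function.Exact φ ψ) (hψ : Function.Surjective ψ)
    (FM : MinimalFreeResolution I M) (FP : MinimalFreeResolution I P)
    (FN : MinimalFreeResolution I N) :
    FN.defect ≤ max (min (dMap I φ) (dConnecting I φ ψ hφ h hψ + 1))
        (max FP.defect (FM.defect + 1)) ∧
    FP.defect ≤ max (min (dConnecting I φ ψ hφ h hψ) (dMap I ψ)) (max FM.defect FN.defect) ∧
    FM.defect ≤ max (min (dMap I ψ - 1) (dMap I φ)) (max (FN.defect - 1) FP.defect) := by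
  obtain ⟨σ, δ, hσ, hδ0, hδ⟩ := exists_horseshoe (X := fun i => Fin (FM.rank i) → R)
    (Y := fun i => Fin (FN.rank i) → R) hφ h hψ FM.ε_surjective FM.exact_zero FM.exact_succ
    FN.exact_zero.apply_apply_eq_zero FN.d_d
  obtain ⟨f, g, s, t, hf0, hf, hg0, hg, hs, ht⟩ := exists_homotopyEquiv
    (X := fun i => Fin (FP.rank i) → R)
    (Y := fun i => (Fin (FM.rank i) → R) × (Fin (FN.rank i) → R))
    (dY := extD (X := fun i => Fin (FM.rank i) → R) (Y := fun i => Fin (FN.rank i) → R)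
      FM.d FN.d δ) (εY := (φ ∘ₗ FM.ε).coprod σ)
    FP.ε_surjective FP.exact_zero FP.exact_succ
    (horseshoe_surjective (X := fun i => Fin (FM.rank i) → R)
      (Y := fun i => Fin (FN.rank i) → R) h FM.ε_surjective FN.ε_surjective hσ)
    (horseshoe_exact_zero (X := fun i => Fin (FM.rank i) → R)
      (Y := fun i => Fin (FN.rank i) → R) hφ h FM.exact_zero FN.exact_zero hσ hδ0)
    (horseshoe_exact_succ (X := fun i => Fin (FM.rank i) → R)
      (Y := fun i => Fin (FN.rank i) → R) FM.exact_succ FN.exact_succ hδ)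
  -- The extension need not be minimal, so only the vanishing condition is transferred to it from
  -- `FP`.
  have SG {i : ℕ} (hi : FP.defect ≤ i) : TorMapsVanish
      (X := fun i => (Fin (FM.rank i) → R) × (Fin (FN.rank i) → R)) (extD
        (X := fun i => Fin (FM.rank i) → R) (Y := fun i => Fin (FN.rank i) → R)
        FM.d FN.d δ) I i :=
    (FP.torMapsVanish_of_defect_le hi).of_homotopy_retract
      (X := fun i => (Fin (FM.rank i) → R) × (Fin (FN.rank i) → R))
      (Y := fun i => Fin (FP.rank i) → R) g hg f hf s hs
  have hM {i : ℕ} (hi : dMap I φ ≤ i) (x : Fin (FM.rank i) → R) :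
      g i (x, 0) ∈ I • (⊤ : Submodule R (Fin (FP.rank i) → R)) :=
    lift_mem_of_torMap_eq_zero i FM FP φ (fun i => g i ∘ₗ LinearMap.inl R _ _)
      (fun x => by simp [hg0]) (fun i x => by simp [hg, extD_apply]) (of_infIndex_le hi) x
  have hN {i : ℕ} (hi : dMap I ψ ≤ i) (x : Fin (FP.rank i) → R) :
      (f i x).2 ∈ I • (⊤ : Submodule R (Fin (FN.rank i) → R)) :=
    lift_mem_of_torMap_eq_zero i FP FN ψ (fun i => LinearMap.snd R _ _ ∘ₗ f i)
      (fun x => by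
        rw [← hf0]
        simp [h.apply_apply_eq_zero, hσ])
      (fun i x => by
        simp [← hf, extD_apply]) (of_infIndex_le hi) x
  have hC {i : ℕ} (hi : dConnecting I φ ψ hφ h hψ ≤ i) (y : Fin (FN.rank (i + 1)) → R) :
      δ i y ∈ I • (⊤ : Submodule R (Fin (FM.rank i) → R)) :=
    connecting_mem_of_torConnecting_eq_zero hφ h hψ FM FN σ δ hσ hδ0 hδ (of_infIndex_le hi) y
  have cast_succ (i : ℕ) : ((i + 1 : ℕ) : ℕ∞) = i + 1 := by push_cast; rfl
  refine ⟨FN.defect_le fun i hi => ?_, FP.defect_le fun i hi => ?_, FM.defect_le fun i hi => ?_⟩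
  · simp only [max_le_iff, min_le_iff] at hi
    obtain ⟨hd, hP, hM'⟩ := hi
    -- The index `0` cannot occur, since `FM.defect + 1 ≤ 0` is false.
    rcases i with _ | i
    · simp at hM'
    · have hM2 : FM.defect ≤ i := by
        rw [cast_succ] at hM'
        exact (ENat.add_le_add_iff_right ENat.one_ne_top).1 hM'
      rcases hd with hd | hd
      · exact torMapsVanish_right_of_inl FM.d_d hδ hs (hM hd)
          (FM.torMapsVanish_of_defect_le hM2) (SG hP)
      · rw [cast_succ] at hd
        exact torMapsVanish_right_of_connecting
          (hC ((ENat.add_le_add_iff_right ENat.one_ne_top).1 hd)) hδ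
          (FM.torMapsVanish_of_defect_le hM2) (SG hP)
  · simp only [max_le_iff, min_le_iff] at hi
    obtain ⟨hd, hM', hN'⟩ := hi
    have SM := FM.torMapsVanish_of_defect_le hM'
    have SN := FN.torMapsVanish_of_defect_le hN'
    rcases hd with hd | hd
    · exact (torMapsVanish_ext_of_connecting (hC hd) hδ SM SN).of_homotopy_retract
        (X := fun i => Fin (FP.rank i) → R)
        (Y := fun i => (Fin (FM.rank i) → R) × (Fin (FN.rank i) → R)) f hf g hg t ht
    · exact torMapsVanish_middle_of_snd hδ hf hg ht (hN hd) SM SN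
  -- Truncated subtraction is harmless: the other terms of the maximum are nonnegative, and `a - 1 ≤
  -- i` still means `a ≤ i + 1`.
  · simp only [max_le_iff, min_le_iff, tsub_le_iff_right, ← cast_succ] at hi
    obtain ⟨hd, hN', hP⟩ := hi
    have SN := FN.torMapsVanish_of_defect_le hN'
    rcases hd with hd | hd
    · exact torMapsVanish_left_of_snd FM.d_d FN.d_d hδ hs (hN hd) (SG hP) SN
    · exact torMapsVanish_left_of_inl hδ hf hg hs (hM hd)
        (FP.torMapsVanish_of_defect_le hP) SN

end

/-! ### Existence of minimal free resolutions -/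

section Existence

/-- A relation with unit coefficient at `j` expresses `v j` through the other members, so `v j` can
be dropped. -/
lemma exists_shorter_family {R : Type*} [CommRing R] {M : Type*} [AddCommGroup M] [Module R M]
    {n : ℕ} (v : Fin n → M) (r : Fin n → R) (hr : ∑ j, r j • v j = 0) (j : Fin n)
    (hj : IsUnit (r j)) : ∃ m < n, ∃ w : Fin m → M, (∀ i, w i ∈ Set.range v) ∧
      Submodule.span R (Set.range w) = Submodule.span R (Set.range v) := by
  rcases n with _ | n
  · exact j.elim0
  refine ⟨n, n.lt_succ_self, fun i => v (j.succAbove i), fun i => ⟨_, rfl⟩, ?_⟩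
  apply le_antisymm
  · refine Submodule.span_mono ?_
    rintro _ ⟨i, rfl⟩
    exact ⟨_, rfl⟩
  · rw [Submodule.span_le]
    rintro _ ⟨i, rfl⟩
    rcases Fin.eq_self_or_eq_succAbove j i with rfl | ⟨i, rfl⟩
    · rw [Fin.sum_univ_succAbove _ i, add_eq_zero_iff_eq_neg] at hr
      rw [SetLike.mem_coe, ← Submodule.smul_mem_iff_of_isUnit _ hj, hr]
      exact neg_mem (Submodule.sum_mem _ fun l _ =>
        Submodule.smul_mem _ _ (Submodule.subset_span ⟨l, rfl⟩))
    · exact Submodule.subset_span ⟨i, rfl⟩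

/-- A family of elements of `T` that spans `span T` and has the least possible length satisfies no
linear relation with a unit among its coefficients. -/
lemma exists_minimal_family {R : Type*} [CommRing R] {M : Type*} [AddCommGroup M] [Module R M]
    (T : Set M) (hT : (Submodule.span R T).FG) :
    ∃ (n : ℕ) (v : Fin n → M), (∀ j, v j ∈ T) ∧
      Submodule.span R (Set.range v) = Submodule.span R T ∧
      ∀ r : Fin n → R, ∑ j, r j • v j = 0 → ∀ j, ¬ IsUnit (r j) := by
  classical
  have hex : ∃ n, ∃ v : Fin n → M, (∀ j, v j ∈ T) ∧
      Submodule.span R (Set.range v) = Submodule.span R T := by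
    obtain ⟨s, hs, hspan⟩ := (Submodule.fg_span_iff_fg_span_finset_subset T).1 hT
    refine ⟨s.card, fun j => (s.equivFin.symm j : M), fun j => hs (s.equivFin.symm j).2, ?_⟩
    rw [hspan]
    congr 1
    ext x
    constructor
    · rintro ⟨j, rfl⟩
      exact (s.equivFin.symm j).2
    · intro hx
      exact ⟨s.equivFin ⟨x, hx⟩, by simp⟩
  obtain ⟨v, hv, hspan⟩ := Nat.find_spec hex
  refine ⟨Nat.find hex, v, hv, hspan, fun r hr j hj => ?_⟩
  obtain ⟨m, hm, w, hw, hws⟩ := exists_shorter_family v r hr j hj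
  refine Nat.find_min hex hm ⟨w, fun i => ?_, hws.trans hspan⟩
  obtain ⟨l, hl⟩ := hw i
  exact hl ▸ hv l

variable {R : Type u} [CommRing R] {I : Ideal R} {M : Type u} [AddCommGroup M] [Module R M]

/-- Minimal free resolutions, possibly with additional data `D` on the free modules, can be built
step by step. -/
lemma exists_minimalFreeResolution {D : ℕ → Type*}
    (ok : ∀ n, D n → Submodule R (Fin n → R) → Prop)
    (homD : ∀ n n', D n → D n' → ((Fin n' → R) →ₗ[R] (Fin n → R)) → Prop)
    (homE : ∀ n, D n → ((Fin n → R) →ₗ[R] M) → Prop)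
    (start : ∃ (n : ℕ) (a : D n) (ε : (Fin n → R) →ₗ[R] M), Function.Surjective ε ∧
      LinearMap.ker ε ≤ I • ⊤ ∧ ok n a (LinearMap.ker ε) ∧ homE n a ε)
    (step : ∀ n a K, ok n a K → ∃ (n' : ℕ) (a' : D n') (d : (Fin n' → R) →ₗ[R] (Fin n → R)),
      LinearMap.range d = K ∧ LinearMap.ker d ≤ I • ⊤ ∧ ok n' a' (LinearMap.ker d) ∧
        homD n n' a a' d) :
    ∃ (F : MinimalFreeResolution I M) (a : ∀ i, D (F.rank i)), homE _ (a 0) F.ε ∧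
      ∀ i, homD _ _ (a i) (a (i + 1)) (F.d i) := by
  -- A state consists of the rank, the extra data and the kernel still to be covered; the
  -- augmentation is remembered only in degree `0`.
  obtain ⟨s, h1, h2⟩ := exists_seq
    (α := fun _ => Σ n : ℕ, D n × Submodule R (Fin n → R))
    (fun i s => ok s.1 s.2.1 s.2.2 ∧ s.2.2 ≤ I • ⊤ ∧ (i = 0 → ∃ ε : (Fin s.1 → R) →ₗ[R] M,
      Function.Surjective ε ∧ LinearMap.ker ε = s.2.2 ∧ homE s.1 s.2.1 ε))
    (fun i s s' => ∃ d : (Fin s'.1 → R) →ₗ[R] (Fin s.1 → R), LinearMap.range d = s.2.2 ∧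
      LinearMap.ker d = s'.2.2 ∧ homD s.1 s'.1 s.2.1 s'.2.1 d)
    (by
      obtain ⟨n, a, ε, hs, hk, hok, hE⟩ := start
      exact ⟨⟨n, a, LinearMap.ker ε⟩, hok, hk, fun _ => ⟨ε, hs, rfl, hE⟩⟩)
    (fun i ⟨n, a, K⟩ hs => by
      obtain ⟨n', a', d, hr, hk, hok, hD⟩ := step n a K hs.1
      exact ⟨⟨n', a', LinearMap.ker d⟩, ⟨hok, hk, fun h => absurd h (Nat.succ_ne_zero i)⟩,
        d, hr, rfl, hD⟩)
  obtain ⟨ε, hε, hεk, hE⟩ := (h1 0).2.2 rfl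
  choose d hr hk hD using h2
  exact ⟨{ rank := fun i => (s i).1
           d := d
           ε := ε
           ε_surjective := hε
           exact_zero := LinearMap.exact_iff.2 (by rw [hεk, hr])
           exact_succ := fun i => LinearMap.exact_iff.2 (by rw [hk, hr])
           minimal := fun i => by rw [hr]; exact (h1 i).2.1 }, fun i => (s i).2.1, hE, hD⟩

lemma nonempty_minimalFreeResolution [IsNoetherianRing R] [IsLocalRing R] [Module.Finite R M] :
    Nonempty (MinimalFreeResolution (IsLocalRing.maximalIdeal R) M) := by
  have gen {A : Type u} [AddCommGroup A] [Module R A] (K : Submodule R A) (hK : K.FG) :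
      ∃ (n : ℕ) (d : (Fin n → R) →ₗ[R] A), LinearMap.range d = K ∧
        LinearMap.ker d ≤ IsLocalRing.maximalIdeal R • ⊤ := by
    obtain ⟨n, v, -, hv, hmin⟩ := exists_minimal_family (R := R) (K : Set A)
      (by rwa [Submodule.span_eq])
    refine ⟨n, Fintype.linearCombination R v, ?_, fun r hr => ?_⟩
    · rw [Fintype.range_linearCombination, hv, Submodule.span_eq]
    · rw [mem_smul_top_pi]
      -- In a local ring the nonunits are exactly the elements of the maximal ideal.
      exact hmin r (by rwa [LinearMap.mem_ker, Fintype.linearCombination_apply] at hr)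
  obtain ⟨F, -⟩ := exists_minimalFreeResolution (I := IsLocalRing.maximalIdeal R) (M := M)
    (D := fun _ => Unit) (fun _ _ _ => True) (fun _ _ _ _ _ => True) (fun _ _ _ => True)
    (by
      obtain ⟨n, d, hr, hk⟩ := gen (⊤ : Submodule R M) Module.Finite.fg_top
      exact ⟨n, (), d, LinearMap.range_eq_top.1 hr, hk, trivial, trivial⟩)
    (fun n _ K _ => by
      obtain ⟨n', d, hr, hk⟩ := gen K (IsNoetherian.noetherian K)
      exact ⟨n', (), d, hr, hk, trivial, trivial⟩)
  exact ⟨F⟩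

end Existence

/-! ### Graded modules -/

section GradedExistence

variable {k : Type v} [Field k] {R : Type u} [CommRing R] [Algebra k R]
  (𝒜 : ℕ → Submodule k R)

lemma IsStandardGraded.isNoetherianRing [GradedAlgebra 𝒜] (h : IsStandardGraded 𝒜) :
    IsNoetherianRing R := by
  have : Algebra.FiniteType k R := by
    obtain ⟨s, hs⟩ := h.fg_one
    exact ⟨⟨s, by rw [← h.adjoin_one, ← hs, Algebra.adjoin_span]⟩⟩
  exact Algebra.FiniteType.isNoetherianRing k R

/-- The projection of `R` onto its component of degree `e`. -/
def componentProj [GradedAlgebra 𝒜] : ℤ → R →+ R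
  | Int.ofNat n => GradedRing.proj 𝒜 n
  | Int.negSucc _ => 0

/-- The maps `π e` are the projections onto the components `ℳ e` of a graded module. -/
structure IsGradedProj {M : Type*} [AddCommGroup M] [Module R M] (ℳ : ℤ → AddSubgroup M)
    (π : ℤ → M →+ M) : Prop where
  mem : ∀ e x, π e x ∈ ℳ e
  eq_self : ∀ {e x}, x ∈ ℳ e → π e x = x
  eq_zero : ∀ {e e' x}, x ∈ ℳ e' → e ≠ e' → π e x = 0
  sum_eq : ∀ x, ∃ t : Finset ℤ, ∀ s, t ⊆ s → ∑ e ∈ s, π e x = x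
  smul_mem : ∀ {i : ℕ} {j : ℤ} {a : R} {x : M}, a ∈ 𝒜 i → x ∈ ℳ j → a • x ∈ ℳ (i + j)

variable {𝒜}

lemma IsGradedModule.exists_isGradedProj {M : Type u} [AddCommGroup M] [Module R M]
    {ℳ : ℤ → AddSubgroup M} (h : IsGradedModule 𝒜 ℳ) : ∃ π, IsGradedProj 𝒜 ℳ π := by
  classical
  let _ := h.isInternal.chooseDecomposition
  refine ⟨fun e => (ℳ e).subtype.comp ((DFinsupp.evalAddMonoidHom e).comp
    (DirectSum.decomposeAddEquiv ℳ).toAddMonoidHom), ?_⟩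
  refine
    { mem := fun e x => (DirectSum.decompose ℳ x e).2
      eq_self := fun hx => DirectSum.decompose_of_mem_same ℳ hx
      eq_zero := fun hx hne => DirectSum.decompose_of_mem_ne ℳ hx hne.symm
      sum_eq := fun x => ?_
      smul_mem := h.smul_mem }
  refine ⟨DFinsupp.support (DirectSum.decompose ℳ x), fun s hs => ?_⟩
  change ∑ e ∈ s, (DirectSum.decompose ℳ x e : M) = x
  rw [← Finset.sum_subset hs fun e _ he => by
    rw [DFinsupp.notMem_support_iff.1 he]; rfl]
  exact DirectSum.sum_support_decompose ℳ x

variable [GradedAlgebra 𝒜]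

lemma componentProj_of_mem {i : ℕ} {a : R} (ha : a ∈ 𝒜 i) (e : ℤ) :
    componentProj 𝒜 e a = if e = i then a else 0 := by
  rcases e with n | n
  · change (DirectSum.decompose 𝒜 a n : R) = _
    split_ifs with h
    · rw [Int.ofNat_eq_natCast, Nat.cast_inj] at h
      subst h
      exact DirectSum.decompose_of_mem_same 𝒜 ha
    · refine DirectSum.decompose_of_mem_ne 𝒜 ha fun h' => h ?_
      rw [h', Int.ofNat_eq_natCast]
  · rw [if_neg (by omega)]
    rfl

variable (𝒜) in
lemma isGradedProj_self :
    IsGradedProj 𝒜 (fun e => (component 𝒜 e).toAddSubgroup) (componentProj 𝒜) where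
  mem := fun e x => by
    rcases e with n | n
    · exact (DirectSum.decompose 𝒜 x n).2
    · exact zero_mem _
  eq_self := fun {e x} hx => by
    rcases e with n | n
    · rw [componentProj_of_mem (i := n) hx, if_pos (by simp)]
    · rw [show x = 0 from hx, map_zero]
  eq_zero := fun {e e' x} hx hne => by
    rcases e' with n | n
    · rw [componentProj_of_mem (i := n) hx, if_neg (by simpa using hne)]
    · rw [show x = 0 from hx, map_zero]
  sum_eq := fun x => by
    induction x using DirectSum.Decomposition.inductionOn 𝒜 with
    | zero => exact ⟨∅, fun s _ => by simp⟩
    | @homogeneous i m =>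
      refine ⟨{(i : ℤ)}, fun s hs => ?_⟩
      simp only [componentProj_of_mem m.2]
      rw [Finset.sum_ite_eq', if_pos (hs (Finset.mem_singleton_self _))]
    | add m m' h h' =>
      obtain ⟨t, ht⟩ := h
      obtain ⟨t', ht'⟩ := h'
      refine ⟨t ∪ t', fun s hs => ?_⟩
      simp only [map_add, Finset.sum_add_distrib]
      rw [ht s (Finset.union_subset_left hs), ht' s (Finset.union_subset_right hs)]
  smul_mem := fun {i j a x} ha hx => by
    rcases j with n | n
    · exact SetLike.mul_mem_graded ha hx
    · rw [show x = 0 from hx, smul_zero]; exact zero_mem _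

/-- Used to see that the projections commute with linear combinations of homogeneous generators, so
that the relations among these form a graded submodule. -/
lemma IsGradedProj.smul_of_mem {M : Type*} [AddCommGroup M] [Module R M] {ℳ : ℤ → AddSubgroup M}
    {π : ℤ → M →+ M} (h : IsGradedProj 𝒜 ℳ π) {d : ℤ} {x : M} (hx : x ∈ ℳ d) (e : ℤ) (r : R) :
    π e (r • x) = componentProj 𝒜 (e - d) r • x := by
  induction r using DirectSum.Decomposition.inductionOn 𝒜 with
  | zero => simp
  | @homogeneous i m =>
    have h1 := h.smul_mem m.2 hx
    rw [componentProj_of_mem m.2]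
    split_ifs with he
    · rw [show e = i + d by omega, h.eq_self h1]
    · rw [h.eq_zero h1 (by omega), zero_smul]
  | add m m' h1 h2 => rw [add_smul, map_add, map_add, h1, h2, add_smul]

/-- The grading of the free module `⨁ⱼ R(-deg j)`. -/
def freeGrading (𝒜 : ℕ → Submodule k R) {n : ℕ} (deg : Fin n → ℤ) (e : ℤ) :
    AddSubgroup (Fin n → R) where
  carrier := {x | ∀ l, x l ∈ component 𝒜 (e - deg l)}
  add_mem' := fun ha hb l => add_mem (ha l) (hb l)
  zero_mem' := fun _ => zero_mem _
  neg_mem' := fun ha l => neg_mem (ha l)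

/-- The projections onto the components of the free module `⨁ⱼ R(-deg j)`. -/
def freeProj (𝒜 : ℕ → Submodule k R) [GradedAlgebra 𝒜] {n : ℕ} (deg : Fin n → ℤ) (e : ℤ) :
    (Fin n → R) →+ (Fin n → R) where
  toFun x l := componentProj 𝒜 (e - deg l) (x l)
  map_zero' := by ext; simp
  map_add' x y := by ext; simp

lemma freeProj_apply {n : ℕ} (deg : Fin n → ℤ) (e : ℤ) (x : Fin n → R) (l : Fin n) :
    freeProj 𝒜 deg e x l = componentProj 𝒜 (e - deg l) (x l) := rfl

lemma isGradedProj_free {n : ℕ} (deg : Fin n → ℤ) :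
    IsGradedProj 𝒜 (freeGrading 𝒜 deg) (freeProj 𝒜 deg) where
  mem := fun e x l => (isGradedProj_self 𝒜).mem _ _
  eq_self := fun hx => funext fun l => (isGradedProj_self 𝒜).eq_self (hx l)
  eq_zero := fun hx hne => funext fun l => (isGradedProj_self 𝒜).eq_zero (hx l) (by omega)
  sum_eq := fun x => by
    choose t ht using fun l => (isGradedProj_self 𝒜).sum_eq (x l)
    refine ⟨Finset.univ.biUnion fun l => (t l).image (· + deg l), fun s hs => funext fun l => ?_⟩
    rw [Finset.sum_apply]
    simp only [freeProj_apply]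
    -- Reindexing by `e ↦ e - deg l` undoes the shift in coordinate `l`.
    rw [← Finset.sum_image (s := s) (g := (· - deg l)) (f := fun e => componentProj 𝒜 e (x l))
      (fun a _ b _ hab => by simpa using hab)]
    refine ht l _ fun e he => Finset.mem_image.2 ⟨e + deg l, hs ?_, by simp⟩
    exact Finset.mem_biUnion.2 ⟨l, Finset.mem_univ _, Finset.mem_image_of_mem _ he⟩
  smul_mem := fun {i j a x} ha hx l => by
    rw [add_sub_assoc]
    exact (isGradedProj_self 𝒜).smul_mem ha (hx l)

lemma componentProj_zero_eq_zero_or_isUnit (h0 : 𝒜 0 = 1) (r : R) :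
    componentProj 𝒜 0 r = 0 ∨ IsUnit (componentProj 𝒜 0 r) := by
  have h : componentProj 𝒜 0 r ∈ 𝒜 0 := (isGradedProj_self 𝒜).mem 0 r
  rw [h0, Submodule.mem_one] at h
  obtain ⟨c, hc⟩ := h
  rw [← hc]
  rcases eq_or_ne c 0 with rfl | hc0
  · exact Or.inl (map_zero _)
  · exact Or.inr ((IsUnit.mk0 c hc0).map _)

/-- A submodule stable under the projections is spanned by its homogeneous elements, so a shortest
generating family can be chosen among these. Stability of the kernel is returned as well, which
allows the construction to be iterated. -/
lemma IsGradedProj.exists_minimal_generators {M : Type*} [AddCommGroup M] [Module R M]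
    {ℳ : ℤ → AddSubgroup M} {π : ℤ → M →+ M} (h : IsGradedProj 𝒜 ℳ π) (h0 : 𝒜 0 = 1)
    (K : Submodule R M) (hK : ∀ e, ∀ x ∈ K, π e x ∈ K) (hfg : K.FG) :
    ∃ (n : ℕ) (deg : Fin n → ℤ) (d : (Fin n → R) →ₗ[R] M), LinearMap.range d = K ∧
      LinearMap.ker d ≤ gradedMaxIdeal 𝒜 • ⊤ ∧
      (∀ e, ∀ x ∈ LinearMap.ker d, freeProj 𝒜 deg e x ∈ LinearMap.ker d) ∧
      ∀ j, d (Pi.single j 1) ∈ ℳ (deg j) := by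
  have hspan : Submodule.span R {x | x ∈ K ∧ ∃ e, x ∈ ℳ e} = K := by
    apply le_antisymm
    · exact Submodule.span_le.2 fun x hx => hx.1
    · intro x hx
      obtain ⟨t, ht⟩ := h.sum_eq x
      rw [← ht t subset_rfl]
      exact Submodule.sum_mem _ fun e _ => Submodule.subset_span ⟨hK e x hx, e, h.mem e x⟩
  obtain ⟨n, v, hv, hvs, hmin⟩ := exists_minimal_family {x | x ∈ K ∧ ∃ e, x ∈ ℳ e}
    (by rwa [hspan])
  choose hvK deg hdeg using hv
  have hker (e : ℤ) (x : Fin n → R) (hx : x ∈ LinearMap.ker (Fintype.linearCombination R v)) :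
      freeProj 𝒜 deg e x ∈ LinearMap.ker (Fintype.linearCombination R v) := by
    rw [LinearMap.mem_ker, Fintype.linearCombination_apply] at hx ⊢
    have := congrArg (π e) hx
    rw [map_sum, map_zero] at this
    rw [← this]
    exact Finset.sum_congr rfl fun l _ => (h.smul_of_mem (hdeg l) e (x l)).symm
  refine ⟨n, deg, Fintype.linearCombination R v, ?_, fun x hx => ?_, hker, fun j => ?_⟩
  · rw [Fintype.range_linearCombination, hvs, hspan]
  · rw [mem_smul_top_pi]
    intro j
    -- A nonunit of `R` need not lie in the graded maximal ideal. In the component of degree `deg j`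
    -- of the relation, however, the `j`-th coefficient lies in `𝒜 0`, the image of `k`, where a
    -- nonunit is zero.
    have h1 := hker (deg j) x hx
    rw [LinearMap.mem_ker, Fintype.linearCombination_apply] at h1
    have h2 := hmin _ h1 j
    rw [freeProj_apply, sub_self] at h2
    exact (HomogeneousIdeal.mem_irrelevant_iff 𝒜 _).2
      ((componentProj_zero_eq_zero_or_isUnit h0 (x j)).resolve_right h2)
  · rw [Fintype.linearCombination_apply_single, one_smul]
    exact hdeg j

lemma nonempty_minimalGradedFreeResolution (h𝒜 : IsStandardGraded 𝒜) {M : Type u}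
    [AddCommGroup M] [Module R M] [Module.Finite R M] {ℳ : ℤ → AddSubgroup M}
    (hℳ : IsGradedModule 𝒜 ℳ) : Nonempty (MinimalGradedFreeResolution 𝒜 ℳ) := by
  have := h𝒜.isNoetherianRing
  obtain ⟨π, hπ⟩ := hℳ.exists_isGradedProj
  obtain ⟨F, deg, hE, hD⟩ := exists_minimalFreeResolution (I := gradedMaxIdeal 𝒜) (M := M)
    (D := fun n => Fin n → ℤ) (fun n deg K => ∀ e, ∀ x ∈ K, freeProj 𝒜 deg e x ∈ K)
    (fun n n' deg deg' d => ∀ j, d (Pi.single j 1) ∈ freeGrading 𝒜 deg (deg' j))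
    (fun n deg ε => ∀ j, ε (Pi.single j 1) ∈ ℳ (deg j))
    (by
      obtain ⟨n, deg, d, hr, h⟩ := hπ.exists_minimal_generators h𝒜.zero_eq ⊤
        (fun _ _ _ => trivial) Module.Finite.fg_top
      exact ⟨n, deg, d, LinearMap.range_eq_top.1 hr, h⟩)
    (fun n deg K hK => (isGradedProj_free deg).exists_minimal_generators h𝒜.zero_eq K hK
      (IsNoetherian.noetherian K))
  exact ⟨{ F with deg := deg, ε_mem := hE, d_mem := hD }⟩

end GradedExistence

end LinDefect

end

/-- The first conjunct is the case of a noetherian local ring, the second one the case of a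
standard graded algebra over a field. -/
theorem proposition2p4 :
    (∀ (R : Type u) [CommRing R] [IsNoetherianRing R] [IsLocalRing R]
      (M P N : Type u) [AddCommGroup M] [AddCommGroup P] [AddCommGroup N]
      [Module R M] [Module R P] [Module R N]
      [Module.Finite R M] [Module.Finite R P] [Module.Finite R N]
      [Nontrivial M] [Nontrivial P] [Nontrivial N]
      (φ : M →ₗ[R] P) (ψ : P →ₗ[R] N)
      (hφ : Function.Injective φ) (h : Function.Exact φ ψ) (hψ : Function.Surjective ψ)
      (dM dP dN : ℕ∞)
      (_ : dM = LinDefect.dConnecting (IsLocalRing.maximalIdeal R) φ ψ hφ h hψ)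
      (_ : dP = LinDefect.dMap (IsLocalRing.maximalIdeal R) φ)
      (_ : dN = LinDefect.dMap (IsLocalRing.maximalIdeal R) ψ),
      LinDefect.lind R N ≤
        max (min dP (dM + 1)) (max (LinDefect.lind R P) (LinDefect.lind R M + 1)) ∧
      LinDefect.lind R P ≤
        max (min dM dN) (max (LinDefect.lind R M) (LinDefect.lind R N)) ∧
      LinDefect.lind R M ≤
        max (min (dN - 1) dP) (max (LinDefect.lind R N - 1) (LinDefect.lind R P))) ∧
    (∀ (k : Type v) [Field k] (R : Type u) [CommRing R] [Algebra k R]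
      (𝒜 : ℕ → Submodule k R) [GradedAlgebra 𝒜] (_ : LinDefect.IsStandardGraded 𝒜)
      (M P N : Type u) [AddCommGroup M] [AddCommGroup P] [AddCommGroup N]
      [Module R M] [Module R P] [Module R N]
      [Module.Finite R M] [Module.Finite R P] [Module.Finite R N]
      [Nontrivial M] [Nontrivial P] [Nontrivial N]
      (gM : ℤ → AddSubgroup M) (gP : ℤ → AddSubgroup P) (gN : ℤ → AddSubgroup N)
      (_ : LinDefect.IsGradedModule 𝒜 gM) (_ : LinDefect.IsGradedModule 𝒜 gP)
      (_ : LinDefect.IsGradedModule 𝒜 gN)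
      (φ : M →ₗ[R] P) (ψ : P →ₗ[R] N)
      (_ : ∀ n, ∀ x ∈ gM n, φ x ∈ gP n) (_ : ∀ n, ∀ x ∈ gP n, ψ x ∈ gN n)
      (hφ : Function.Injective φ) (h : Function.Exact φ ψ) (hψ : Function.Surjective ψ)
      (dM dP dN : ℕ∞)
      (_ : dM = LinDefect.dConnecting (LinDefect.gradedMaxIdeal 𝒜) φ ψ hφ h hψ)
      (_ : dP = LinDefect.dMap (LinDefect.gradedMaxIdeal 𝒜) φ)
      (_ : dN = LinDefect.dMap (LinDefect.gradedMaxIdeal 𝒜) ψ),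
      LinDefect.gradedLind 𝒜 gN ≤
        max (min dP (dM + 1)) (max (LinDefect.gradedLind 𝒜 gP) (LinDefect.gradedLind 𝒜 gM + 1)) ∧
      LinDefect.gradedLind 𝒜 gP ≤
        max (min dM dN) (max (LinDefect.gradedLind 𝒜 gM) (LinDefect.gradedLind 𝒜 gN)) ∧
      LinDefect.gradedLind 𝒜 gM ≤
        max (min (dN - 1) dP)
          (max (LinDefect.gradedLind 𝒜 gN - 1) (LinDefect.gradedLind 𝒜 gP))) := by
  refine ⟨?_, ?_⟩
  · intro R _ _ _ M P N _ _ _ _ _ _ _ _ _ _ _ _ φ ψ hφ h hψ dM dP dN hdM hdP hdN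
    obtain ⟨FM⟩ := LinDefect.nonempty_minimalFreeResolution (R := R) (M := M)
    obtain ⟨FP⟩ := LinDefect.nonempty_minimalFreeResolution (R := R) (M := P)
    obtain ⟨FN⟩ := LinDefect.nonempty_minimalFreeResolution (R := R) (M := N)
    have hM : FM.defect ≤ LinDefect.lind R M := le_iSup (fun F => F.defect) FM
    have hP : FP.defect ≤ LinDefect.lind R P := le_iSup (fun F => F.defect) FP
    have hN : FN.defect ≤ LinDefect.lind R N := le_iSup (fun F => F.defect) FN
    subst hdM hdP hdN
    -- The supremum on the left is bounded at every resolution `F`, while the suprema on the right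
    -- dominate the defects of the chosen ones. Thus existence of minimal resolutions is needed
    -- here, but not their uniqueness.
    refine ⟨iSup_le fun F => ?_, iSup_le fun F => ?_, iSup_le fun F => ?_⟩
    · refine (LinDefect.defect_le_of_shortExact hφ h hψ FM FP F).1.trans ?_
      gcongr
    · refine (LinDefect.defect_le_of_shortExact hφ h hψ FM F FN).2.1.trans ?_
      gcongr
    · refine (LinDefect.defect_le_of_shortExact hφ h hψ F FP FN).2.2.trans ?_
      gcongr
  · intro k _ R _ _ 𝒜 _ h𝒜 M P N _ _ _ _ _ _ _ _ _ _ _ _ gM gP gN hgM hgP hgN φ ψ _ _ hφ h hψ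
      dM dP dN hdM hdP hdN
    obtain ⟨FM⟩ := LinDefect.nonempty_minimalGradedFreeResolution h𝒜 hgM
    obtain ⟨FP⟩ := LinDefect.nonempty_minimalGradedFreeResolution h𝒜 hgP
    obtain ⟨FN⟩ := LinDefect.nonempty_minimalGradedFreeResolution h𝒜 hgN
    have hM : FM.defect ≤ LinDefect.gradedLind 𝒜 gM :=
      le_iSup (fun F : LinDefect.MinimalGradedFreeResolution 𝒜 gM => F.defect) FM
    have hP : FP.defect ≤ LinDefect.gradedLind 𝒜 gP :=
      le_iSup (fun F : LinDefect.MinimalGradedFreeResolution 𝒜 gP => F.defect) FP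
    have hN : FN.defect ≤ LinDefect.gradedLind 𝒜 gN :=
      le_iSup (fun F : LinDefect.MinimalGradedFreeResolution 𝒜 gN => F.defect) FN
    subst hdM hdP hdN
    refine ⟨iSup_le fun F => ?_, iSup_le fun F => ?_, iSup_le fun F => ?_⟩
    · refine (LinDefect.defect_le_of_shortExact hφ h hψ FM.toMinimalFreeResolution
        FP.toMinimalFreeResolution F.toMinimalFreeResolution).1.trans ?_
      gcongr
    · refine (LinDefect.defect_le_of_shortExact hφ h hψ FM.toMinimalFreeResolution
        F.toMinimalFreeResolution FN.toMinimalFreeResolution).2.1.trans ?_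
      gcongr
    · refine (LinDefect.defect_le_of_shortExact hφ h hψ F.toMinimalFreeResolution
        FP.toMinimalFreeResolution FN.toMinimalFreeResolution).2.2.trans ?_
      gcongr
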